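/- Let $d\ge 1$, let $D\subset\mathbb{R}^d$ be open and let $1<p<\infty$. For $A\subset\mathbb{R}^d$ let $\mathrm{cap}_p(A)$ be the infimum of $\int_{\mathbb{R}^d}(|u|^p+|\nabla u|^p)\,dx$ over all $u\in W^{1,p}(\mathbb{R}^d)$ with $u\ge1$ a.e. on a neighbourhood of $A$. "Quasi-everywhere" (q.e.) means outside a set of zero $p$-capacity, and every $u\in W^{1,p}(\mathbb{R}^d)$ is identified with a $p$-quasi-continuous representative. A set is $p$-quasi-open if it is $\{u>0\}$ for some $u\in W^{1,p}(\mathbb{R}^d)$. A $p$-capacitary measure is a nonnegative Borel measure $\mu$ on $\mathbb{R}^d$, possibly taking the value $+\infty$, such that for every Borel set $E$ one has $\mu(E)=0$ whenever $\mathrm{cap}_p(E)=0$, and $\mu(E)=\inf\{\mu(\Omega):\Omega\supset E,\ \Omega\ p\text{-quasi-open}\}$. Let $V$ be one of the spaces $W^{1,p}_0(D)$ (functions of $W^{1,p}(\mathbb{R}^d)$ vanishing q.e. outside $D$) or $W^{1,p}(\mathbb{R}^d)$. For a $p$-capacitary measure $\mu$ put $$W^{1,p}_\mu=\Big\{u\in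 V:\ \int|u|^p\,d\mu<\infty\Big\},\qquad \|u\|_{\mu}=\Big(\int_D|\nabla u|^p\,dx+\int|u|^p\,d\mu\Big)^{1/p}.$$ For a linear functional $f$ on $W^{1,p}_\mu$ that is bounded with respect to $\|\cdot\|_\mu$, a solution $u_{\mu,f}$ of $-\Delta_pu+\mu|u|^{p-2}u=f$ is a function $u\in W^{1,p}_\mu$ with $$\int_D|\nabla u|^{p-2}\nabla u\cdot\nabla v\,dx+\int|u|^{p-2}uv\,d\mu=\langle f,v\rangle\qquad\text{for all }v\in W^{1,p}_\mu .$$ For functionals, $f_1\le f_2$ means $\langle f_1,v\rangle\le\langle f_2,v\rangle$ for all $v\in W^{1,p}_\mu$ with $v\ge0$. If $V=W^{1,p}(\mathbb{R}^d)$, assume in addition that $\|\cdot\|_{\mu}$ is definite on $D$, that is, $w\in W^{1,p}_\mu$ and $\|w\|_\mu=0$ imply $w=0$ q.e. in $D$ (for $\mu=\mu_2$ in the first statement below). Then, for all solutions of the respective equations: 1. If $\mu_1\ge\mu_2$ are $p$-capacitary measures and $f\ge0$ is in the dual of $W^{1,p}_{\mu_2}$, then $u_{\mu_1,f}\le u_{\mu_2,f}$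 (where $f$ is restricted to $W^{1,p}_{\mu_1}\subset W^{1,p}_{\mu_2}$ in the equation for $u_{\mu_1,f}$). 2. If $\mu$ is a $p$-capacitary measure and $f_1\le f_2$ are in the dual of $W^{1,p}_{\mu}$, then $u_{\mu,f_1}\le u_{\mu,f_2}$. The inequalities hold q.e. in $\mathbb{R}^d$ (hence a.e.) if $V=W^{1,p}_0(D)$, and q.e. in $D$ if $V=W^{1,p}(\mathbb{R}^d)$. -/

import Mathlib

open MeasureTheory Set
open scoped ENNReal ContDiff

noncomputable section

/-- The Euclidean space `ℝ^d`. -/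
abbrev Rd (d : ℕ) : Type := EuclideanSpace ℝ (Fin d)

/-- `g` is a weak (distributional) gradient of `u` on `ℝ^d`:
`∫ u ∂_e φ dx = - ∫ ⟨g, e⟩ φ dx` for all `φ ∈ C_c^∞(ℝ^d)` and all directions `e`. -/
def HasWeakGradient {d : ℕ} (u : Rd d → ℝ) (g : Rd d → Rd d) : Prop :=
  LocallyIntegrable u volume ∧ LocallyIntegrable g volume ∧
    ∀ φ : Rd d → ℝ, ContDiff ℝ ∞ φ → HasCompactSupport φ → ∀ e : Rd d,
      ∫ x, u x * fderiv ℝ φ x e = - ∫ x, inner ℝ (g x) e * φ x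

open Classical in
/-- The weak gradient of `u` (unique up to a Lebesgue-null set when it exists). -/
def weakGrad {d : ℕ} (u : Rd d → ℝ) : Rd d → Rd d :=
  if h : ∃ g, HasWeakGradient u g then h.choose else 0

/-- `u ∈ W^{1,p}(ℝ^d)`. -/
def MemW1p {d : ℕ} (p : ℝ) (u : Rd d → ℝ) : Prop :=
  MemLp u (ENNReal.ofReal p) volume ∧
    ∃ g, HasWeakGradient u g ∧ MemLp g (ENNReal.ofReal p) volume

/-- The `p`-capacity of `A ⊆ ℝ^d`: the infimum of `∫ (|u|^p + |∇u|^p) dx` over all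
`u ∈ W^{1,p}(ℝ^d)` with `u ≥ 1` almost everywhere on a neighbourhood of `A`. -/
def pCapacity {d : ℕ} (p : ℝ) (A : Set (Rd d)) : ℝ≥0∞ :=
  ⨅ (u : Rd d → ℝ) (_ : MemW1p p u)
    (_ : ∃ U : Set (Rd d), IsOpen U ∧ A ⊆ U ∧ ∀ᵐ x ∂volume, x ∈ U → 1 ≤ u x),
    ∫⁻ x, (ENNReal.ofReal (|u x| ^ p) + ENNReal.ofReal (‖weakGrad u x‖ ^ p))

/-- `P` holds `p`-quasi-everywhere, i.e. outside a set of zero `p`-capacity. -/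
def QuasiEverywhere {d : ℕ} (p : ℝ) (P : Rd d → Prop) : Prop :=
  pCapacity p {x | ¬ P x} = 0

/-- `u` is `p`-quasi-continuous: continuous outside open sets of arbitrarily small capacity. -/
def QuasiContinuous {d : ℕ} (p : ℝ) (u : Rd d → ℝ) : Prop :=
  ∀ ε : ℝ≥0∞, 0 < ε → ∃ G : Set (Rd d), IsOpen G ∧ pCapacity p G < ε ∧ ContinuousOn u Gᶜ

/-- `W^{1,p}(ℝ^d)`, each element given by a quasi-continuous representative (which always exists
and is unique up to a set of zero capacity); this is the usual convention that gives a meaning to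
level sets and to integrals with respect to measures which do not charge sets of zero capacity. -/
def sobolev (d : ℕ) (p : ℝ) : Set (Rd d → ℝ) :=
  {u | MemW1p p u ∧ QuasiContinuous p u}

/-- `W^{1,p}_0(D)` for `D` open, as a subspace of `W^{1,p}(ℝ^d)` (functions extended by zero):
the functions of `W^{1,p}(ℝ^d)` that vanish quasi-everywhere outside `D`. -/
def sobolevZero {d : ℕ} (p : ℝ) (D : Set (Rd d)) : Set (Rd d → ℝ) :=
  {u | u ∈ sobolev d p ∧ QuasiEverywhere p (fun x => x ∉ D → u x = 0)}

/-- `Ω` is `p`-quasi-open: `Ω = {u > 0}` for some `u ∈ W^{1,p}(ℝ^d)`. -/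
def IsQuasiOpen {d : ℕ} (p : ℝ) (Ω : Set (Rd d)) : Prop :=
  ∃ u ∈ sobolev d p, Ω = {x | 0 < u x}

/-- `μ` is a `p`-capacitary measure on `ℝ^d` (a Borel measure, possibly taking the value `∞`). -/
def IsCapacitary {d : ℕ} (p : ℝ) (μ : Measure (Rd d)) : Prop :=
  (∀ A : Set (Rd d), MeasurableSet A → pCapacity p A = 0 → μ A = 0) ∧
  (∀ A : Set (Rd d), MeasurableSet A →
    μ A = ⨅ (Ω : Set (Rd d)) (_ : A ⊆ Ω) (_ : IsQuasiOpen p Ω), μ Ω)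

/-- The functions of `V` (`V` being `W^{1,p}_0(D)` or `W^{1,p}(ℝ^d)`) with `∫ |u|^p dμ < ∞`,
i.e. the space `W^{1,p}_μ`. -/
def sobolevMu {d : ℕ} (V : Set (Rd d → ℝ)) (p : ℝ) (μ : Measure (Rd d)) : Set (Rd d → ℝ) :=
  {u | u ∈ V ∧ MemLp u (ENNReal.ofReal p) μ}

/-- `(∫_D |∇u|^p dx + ∫ |u|^p dμ)^{1/p}`. -/
def normMu {d : ℕ} (D : Set (Rd d)) (p : ℝ) (μ : Measure (Rd d)) (u : Rd d → ℝ) : ℝ :=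
  ((∫ x in D, ‖weakGrad u x‖ ^ p) + ∫ x, |u x| ^ p ∂μ) ^ (1 / p)

/-- `f` is an element of the dual of `W^{1,p}_μ`: a linear functional on that space, bounded with
respect to `normMu`. (Values of `f` outside the space are irrelevant.) -/
def IsDual {d : ℕ} (V : Set (Rd d → ℝ)) (D : Set (Rd d)) (p : ℝ) (μ : Measure (Rd d))
    (f : (Rd d → ℝ) → ℝ) : Prop :=
  (∀ v ∈ sobolevMu V p μ, ∀ w ∈ sobolevMu V p μ, f (v + w) = f v + f w) ∧
  (∀ c : ℝ, ∀ v ∈ sobolevMu V p μ, f (c • v) = c * f v) ∧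
  ∃ C : ℝ, ∀ v ∈ sobolevMu V p μ, |f v| ≤ C * normMu D p μ v

/-- `f ≤ g` as functionals on `W^{1,p}_μ`: `⟨f, v⟩ ≤ ⟨g, v⟩` for all `v ≥ 0` in `W^{1,p}_μ`. -/
def DualLE {d : ℕ} (V : Set (Rd d → ℝ)) (p : ℝ) (μ : Measure (Rd d))
    (f g : (Rd d → ℝ) → ℝ) : Prop :=
  ∀ v ∈ sobolevMu V p μ, (∀ x, 0 ≤ v x) → f v ≤ g v

/-- `u` is a weak solution of `-Δ_p u + μ |u|^{p-2} u = f` in the space `W^{1,p}_μ`. -/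
def IsWeakSolution {d : ℕ} (V : Set (Rd d → ℝ)) (D : Set (Rd d)) (p : ℝ) (μ : Measure (Rd d))
    (f : (Rd d → ℝ) → ℝ) (u : Rd d → ℝ) : Prop :=
  u ∈ sobolevMu V p μ ∧ ∀ v ∈ sobolevMu V p μ,
    (∫ x in D, ‖weakGrad u x‖ ^ (p - 2) * inner ℝ (weakGrad u x) (weakGrad v x)) +
      (∫ x, |u x| ^ (p - 2) * u x * v x ∂μ) = f v

/-- `normMu` is a norm on the restrictions to `D` of the functions of `W^{1,p}_μ`: only the zero
function on `D` has norm zero. -/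
def NormMuDefinite {d : ℕ} (V : Set (Rd d → ℝ)) (D : Set (Rd d)) (p : ℝ)
    (μ : Measure (Rd d)) : Prop :=
  ∀ w ∈ sobolevMu V p μ, normMu D p μ w = 0 → QuasiEverywhere p (fun x => x ∈ D → w x = 0)

end

/-! Both comparisons test the difference of two equations with a positive part. The map `a ↦ ‖a‖ ^
(p - 2) • a` is strictly monotone, and `v = (u₁ - u₂)⁺` and its weak gradient each equal the
corresponding difference or zero. So once the form at `u₁`, tested with `v`, is at most the form at
`u₂`, two nonnegative integrals have nonpositive sum. Both vanish, whence `∇v = 0` a.e. in `D` and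
`v = 0` `μ`-a.e. (`posPart_sub_ae_eq_zero`), and definiteness of the norm gives `v = 0` q.e.

For ordered functionals the inequality of forms is immediate. For ordered measures, comparing `0`
with `u₂` first shows that the negative part of `u₂` is negligible, so `u₂` may be replaced by `U =
u₂⁺`. Then `v = (u₁ - U)⁺` lies between `0` and `|u₁|`, hence is admissible for `μ₁` too, and `u₁ >
0` where `v > 0`. Passing from `μ₁` to `μ₂` therefore only lowers the potential term at `u₁`.

In `W^{1,p}_0(D)` definiteness is automatic: a gradient vanishing in `D` vanishes everywhere,
because it is zero a.e. on the zero set. The function is then a constant in `L^p(ℝ^d)`, so zero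
a.e., and zero q.e. by quasi-continuity.

The rest supplies the lattice structure of `W^{1,p}`: a chain rule by mollification, the gradient of
the positive part, and subadditivity of capacity through `max u v`. -/

noncomputable section

open Filter Topology Convolution ContinuousLinearMap

/-! ### Mollification -/

/-- A sequence of bump functions at the origin whose supports shrink to the origin. -/
def mollifierBump (d n : ℕ) : ContDiffBump (0 : Rd d) where
  -- The ratio of the radii stays equal to 2; a bounded ratio is what a.e. convergence of the
  -- mollifications requires.
  rIn := 1 / (2 * ((n : ℝ) + 1))
  rOut := 1 / ((n : ℝ) + 1)
  rIn_pos := by positivity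
  rIn_lt_rOut := by
    apply one_div_lt_one_div_of_lt <;> nlinarith [n.cast_nonneg (α := ℝ)]

theorem mollifierBump_rOut_tendsto (d : ℕ) :
    Tendsto (fun n => (mollifierBump d n).rOut) atTop (𝓝 0) :=
  tendsto_one_div_add_atTop_nhds_zero_nat

theorem mollifierBump_rOut_le_one (d n : ℕ) : (mollifierBump d n).rOut ≤ 1 := by
  change 1 / ((n : ℝ) + 1) ≤ 1
  rw [div_le_one (by positivity)]
  linarith [n.cast_nonneg (α := ℝ)]

/-- The normalized mollifiers. -/
def mollifier (d n : ℕ) : Rd d → ℝ := (mollifierBump d n).normed volume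

/-- The mollification of a real function. -/
def mollify {d : ℕ} (n : ℕ) (h : Rd d → ℝ) : Rd d → ℝ :=
  mollifier d n ⋆[lsmul ℝ ℝ, volume] h

variable {d : ℕ}

theorem mollify_apply (n : ℕ) (h : Rd d → ℝ) (x : Rd d) :
    mollify n h x = ∫ t, mollifier d n t * h (x - t) := rfl

theorem mollifier_contDiff (n : ℕ) : ContDiff ℝ ∞ (mollifier d n) :=
  (mollifierBump d n).contDiff_normed

theorem mollifier_hasCompactSupport (n : ℕ) : HasCompactSupport (mollifier d n) :=
  (mollifierBump d n).hasCompactSupport_normed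

theorem mollifier_nonneg (n : ℕ) (x : Rd d) : 0 ≤ mollifier d n x :=
  (mollifierBump d n).nonneg_normed x

theorem mollifier_integral (n : ℕ) : ∫ x, mollifier d n x = 1 :=
  (mollifierBump d n).integral_normed

theorem mollifier_integrable (n : ℕ) : Integrable (mollifier d n) :=
  (mollifierBump d n).integrable_normed

theorem mollifier_eq_zero (n : ℕ) {x : Rd d} (hx : (mollifierBump d n).rOut ≤ ‖x‖) :
    mollifier d n x = 0 := by
  have h := (mollifierBump d n).support_normed_eq (μ := (volume : Measure (Rd d)))
  by_contra hne
  have : x ∈ Function.support (mollifier d n) := hne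
  rw [mollifier, h] at this
  simp at this
  linarith

theorem mollify_tendsto_ae {h : Rd d → ℝ} (hh : LocallyIntegrable h) :
    ∀ᵐ x, Tendsto (fun n => mollify n h x) atTop (𝓝 (h x)) := by
  refine ContDiffBump.ae_convolution_tendsto_right_of_locallyIntegrable
    (mollifierBump_rOut_tendsto d) (K := 2) (Eventually.of_forall fun n => ?_) hh
  change 1 / ((n : ℝ) + 1) ≤ 2 * (1 / (2 * ((n : ℝ) + 1)))
  apply le_of_eq
  field_simp

theorem mollify_contDiff {h : Rd d → ℝ} (hh : LocallyIntegrable h) (n : ℕ) :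
    ContDiff ℝ ∞ (mollify n h) :=
  (mollifier_hasCompactSupport n).contDiff_convolution_left _ (mollifier_contDiff n) hh

theorem mollifier_mul_integrable {h : Rd d → ℝ} (hh : LocallyIntegrable h) (n : ℕ) (x : Rd d) :
    Integrable (fun t => mollifier d n t * h (x - t)) :=
  (mollifier_hasCompactSupport n).convolutionExists_left (lsmul ℝ ℝ)
    (mollifier_contDiff n).continuous hh x

theorem mollify_sub {h k : Rd d → ℝ} (hh : LocallyIntegrable h) (hk : LocallyIntegrable k)
    (n : ℕ) (x : Rd d) : mollify n (h - k) x = mollify n h x - mollify n k x := by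
  simp only [mollify_apply, Pi.sub_apply, mul_sub]
  exact integral_sub (mollifier_mul_integrable hh n x) (mollifier_mul_integrable hk n x)

theorem mollify_integrable {h : Rd d → ℝ} (hh : Integrable h) (n : ℕ) :
    Integrable (mollify n h) :=
  (mollifier_integrable n).integrable_convolution _ hh

/-- Mollification is a contraction in `L¹`. -/
theorem integral_abs_mollify_le {h : Rd d → ℝ} (hh : Integrable h) (n : ℕ) :
    ∫ x, |mollify n h x| ≤ ∫ x, |h x| := by
  calc ∫ x, |mollify n h x| ≤ ∫ x, mollify n (fun y => |h y|) x := by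
        refine integral_mono (mollify_integrable hh n).abs (mollify_integrable hh.abs n) fun x => ?_
        simp only [mollify_apply]
        refine (abs_integral_le_integral_abs).trans (le_of_eq ?_)
        simp only [abs_mul, abs_of_nonneg (mollifier_nonneg n _)]
    _ = ∫ x, |h x| := by
        have := integral_convolution (lsmul ℝ ℝ) (mollifier_integrable (d := d) n) hh.abs
        rw [mollifier_integral] at this
        simpa [mollify] using this

/-- If `h` vanishes outside a ball, then its mollifications vanish outside a larger ball. -/
theorem mollify_eq_zero {h : Rd d → ℝ} {R : ℝ} (hR : ∀ x, R ≤ ‖x‖ → h x = 0) (n : ℕ) {x : Rd d}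
    (hx : R + 1 ≤ ‖x‖) : mollify n h x = 0 := by
  rw [mollify_apply]
  refine (integral_congr_ae (Eventually.of_forall fun t => ?_)).trans (integral_zero _ _)
  by_cases ht : (mollifierBump d n).rOut ≤ ‖t‖
  · simp [mollifier_eq_zero n ht]
  · have := mollifierBump_rOut_le_one d n
    have h2 := norm_sub_norm_le x t
    simp [hR (x - t) (by linarith)]

theorem integral_abs_mollify_sub_tendsto_of_continuous {k : Rd d → ℝ} (hk : Continuous k)
    (hc : HasCompactSupport k) :
    Tendsto (fun n => ∫ x, |mollify n k x - k x|) atTop (𝓝 0) := by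
  obtain ⟨R, hR⟩ : ∃ R : ℝ, ∀ x : Rd d, R ≤ ‖x‖ → k x = 0 := by
    obtain ⟨R, hR⟩ := hc.isCompact.isBounded.subset_ball 0
    refine ⟨R, fun x hx => image_eq_zero_of_notMem_tsupport fun hxk => ?_⟩
    have := hR hxk
    simp at this
    linarith
  obtain ⟨C, hC⟩ := hc.exists_bound_of_continuous hk
  have hbound : ∀ n x, |mollify n k x| ≤ C := fun n x => by
    rw [mollify_apply]
    calc |∫ t, mollifier d n t * k (x - t)| ≤ ∫ t, |mollifier d n t * k (x - t)| :=
          abs_integral_le_integral_abs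
      _ ≤ ∫ t, mollifier d n t * C := by
          refine integral_mono (mollifier_mul_integrable hk.locallyIntegrable n x).abs
            ((mollifier_integrable n).mul_const C) fun t => ?_
          simp only [abs_mul, abs_of_nonneg (mollifier_nonneg n _)]
          exact mul_le_mul_of_nonneg_left (hC _) (mollifier_nonneg n t)
      _ = C := by rw [integral_mul_const, mollifier_integral, one_mul]
  have key : Tendsto (fun n => ∫ x, |mollify n k x - k x|) atTop
      (𝓝 (∫ _ : Rd d, (0 : ℝ))) := by
    refine tendsto_integral_of_dominated_convergence
      ((Metric.closedBall 0 (R + 1)).indicator fun _ => 2 * C) (fun n => ?_) ?_ (fun n => ?_) ?_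
    · exact ((mollify_contDiff hk.locallyIntegrable n).continuous.sub hk).abs.aestronglyMeasurable
    · exact (integrable_indicator_iff measurableSet_closedBall).2
        (integrableOn_const (isCompact_closedBall _ _).measure_lt_top.ne)
    · refine Eventually.of_forall fun x => ?_
      by_cases hx : x ∈ Metric.closedBall (0 : Rd d) (R + 1)
      · rw [indicator_of_mem hx, Real.norm_eq_abs, abs_abs]
        have h1 := hbound n x
        have h2 := hC x
        rw [Real.norm_eq_abs] at h2
        linarith [abs_sub (mollify n k x) (k x)]
      · rw [indicator_of_notMem hx]
        simp at hx
        simp [mollify_eq_zero hR n hx.le, hR x (by linarith)]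
    · filter_upwards [mollify_tendsto_ae hk.locallyIntegrable] with x hx
      simpa using (hx.sub_const (k x)).abs
  simpa using key

/-- Mollifications of an integrable function converge to it in `L¹`. -/
theorem integral_abs_mollify_sub_tendsto {h : Rd d → ℝ} (hh : Integrable h) :
    Tendsto (fun n => ∫ x, |mollify n h x - h x|) atTop (𝓝 0) := by
  rw [Metric.tendsto_atTop]
  intro ε hε
  -- The error `h - k` enters twice, once mollified (bounded by the `L¹` contraction) and once as it
  -- is; the error for `k` itself is the third `ε / 4`.
  obtain ⟨k, hkc, hk, hkcont, hkint⟩ :=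
    hh.exists_hasCompactSupport_integral_sub_le (ε := ε / 4) (by positivity)
  obtain ⟨N, hN⟩ := Metric.tendsto_atTop.1
    (integral_abs_mollify_sub_tendsto_of_continuous hkcont hkc) (ε / 4) (by positivity)
  refine ⟨N, fun n hn => ?_⟩
  have h0 : 0 ≤ ∫ x, |mollify n h x - h x| := integral_nonneg fun x => abs_nonneg _
  rw [Real.dist_eq, sub_zero, abs_of_nonneg h0]
  have h1 := hN n hn
  rw [Real.dist_eq, sub_zero] at h1
  have h1' := (le_abs_self _).trans_lt h1
  have hi1 := (mollify_integrable (hh.sub hkint) n).abs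
  have hi2 : Integrable fun x => |mollify n k x - k x| :=
    ((mollify_integrable hkint n).sub hkint).abs
  have hi3 : Integrable fun x => |h x - k x| := (hh.sub hkint).abs
  have h2 : ∫ x, |mollify n h x - h x| ≤ ∫ x, (|mollify n (h - k) x|
      + |mollify n k x - k x| + |h x - k x|) := by
    refine integral_mono ((mollify_integrable hh n).sub hh).abs ((hi1.add hi2).add hi3)
      fun x => ?_
    simp only [mollify_sub hh.locallyIntegrable hkint.locallyIntegrable]
    have e : mollify n h x - h x = (mollify n h x - mollify n k x) + (mollify n k x - k x)
      - (h x - k x) := by ring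
    rw [e]
    exact (abs_sub _ _).trans (by gcongr; exact abs_add_le _ _)
  have hi12 : Integrable fun x => |mollify n (h - k) x| + |mollify n k x - k x| := hi1.add hi2
  rw [integral_add hi12 hi3, integral_add hi1 hi2] at h2
  have h3 := integral_abs_mollify_le (hh.sub hkint) n
  simp only [Pi.sub_apply] at h3
  simp only [Real.norm_eq_abs] at hk
  linarith

/-- Mollifications of a locally integrable function converge to it in `L¹_loc`. -/
theorem integral_abs_mollify_sub_mul_tendsto {h : Rd d → ℝ} (hh : LocallyIntegrable h)
    {ψ : Rd d → ℝ} (hψ : Continuous ψ) (hc : HasCompactSupport ψ) :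
    Tendsto (fun n => ∫ x, |mollify n h x - h x| * |ψ x|) atTop (𝓝 0) := by
  obtain ⟨R, hR⟩ : ∃ R : ℝ, ∀ x : Rd d, R ≤ ‖x‖ → ψ x = 0 := by
    obtain ⟨R, hR⟩ := hc.isCompact.isBounded.subset_ball 0
    refine ⟨R, fun x hx => image_eq_zero_of_notMem_tsupport fun hxk => ?_⟩
    have := hR hxk
    simp at this
    linarith
  obtain ⟨C, hC⟩ := hc.exists_bound_of_continuous hψ
  -- The mollifiers have radius at most 1, so truncating `h` beyond `R + 1` changes nothing where
  -- `ψ` can be nonzero.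
  set k : Rd d → ℝ := (Metric.closedBall 0 (R + 1)).indicator h with hkdef
  have hk : Integrable k := (integrable_indicator_iff measurableSet_closedBall).2
    (hh.integrableOn_isCompact (isCompact_closedBall _ _))
  have hloc : ∀ n x, |mollify n h x - h x| * |ψ x| = |mollify n k x - k x| * |ψ x| := by
    intro n x
    by_cases hx : R ≤ ‖x‖
    · simp [hR x hx]
    · push Not at hx
      have e1 : k x = h x := indicator_of_mem (by simp; linarith) _
      have e2 : mollify n k x = mollify n h x := by
        simp only [mollify_apply]
        refine integral_congr_ae (Eventually.of_forall fun t => ?_)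
        by_cases ht : (mollifierBump d n).rOut ≤ ‖t‖
        · simp [mollifier_eq_zero n ht]
        · have := mollifierBump_rOut_le_one d n
          have h2 := norm_sub_le x t
          have : k (x - t) = h (x - t) := indicator_of_mem (by simp; linarith) _
          simp only [this]
      rw [e1, e2]
  simp only [hloc]
  have hlim := (integral_abs_mollify_sub_tendsto hk).mul_const C
  rw [zero_mul] at hlim
  refine squeeze_zero (fun n => integral_nonneg fun x => by positivity) (fun n => ?_) hlim
  rw [← integral_mul_const]
  have hi := ((mollify_integrable hk n).sub hk).abs
  refine integral_mono_of_nonneg (Eventually.of_forall fun x => by positivity)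
    (hi.mul_const C) (Eventually.of_forall fun x => ?_)
  exact mul_le_mul_of_nonneg_left (hC x) (abs_nonneg _)

/-- The derivative of a mollification is the mollification of the weak derivative. -/
theorem HasWeakGradient.fderiv_mollify {u : Rd d → ℝ} {g : Rd d → Rd d}
    (hu : HasWeakGradient u g) (n : ℕ) (x e : Rd d) :
    fderiv ℝ (mollify n u) x e = mollify n (fun y => inner ℝ (g y) e) x := by
  have hρ := mollifier_contDiff (d := d) n
  have hcd : Continuous (fderiv ℝ (mollifier d n)) := hρ.continuous_fderiv (by simp)
  have hd : HasFDerivAt (mollify n u)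
      (∫ t, (lsmul ℝ ℝ : ℝ →L[ℝ] ℝ →L[ℝ] ℝ).precompL (Rd d) (fderiv ℝ (mollifier d n) t)
        (u (x - t))) x :=
    (mollifier_hasCompactSupport n).hasFDerivAt_convolution_left (lsmul ℝ ℝ)
      (hρ.of_le (by norm_cast)) hu.1 x
  have hint : Integrable fun t => (lsmul ℝ ℝ : ℝ →L[ℝ] ℝ →L[ℝ] ℝ).precompL (Rd d)
      (fderiv ℝ (mollifier d n) t) (u (x - t)) :=
    ((mollifier_hasCompactSupport n).fderiv (𝕜 := ℝ)).convolutionExists_left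
      ((lsmul ℝ ℝ : ℝ →L[ℝ] ℝ →L[ℝ] ℝ).precompL (Rd d)) hcd hu.1 x
  have hfd : fderiv ℝ (mollify n u) x e = ∫ t, fderiv ℝ (mollifier d n) t e * u (x - t) := by
    rw [hd.fderiv, ContinuousLinearMap.integral_apply hint]
    rfl
  -- The reflected mollifier centred at `x` is the test function; the sign from the reflection
  -- cancels the sign in the weak gradient.
  have hφ : ContDiff ℝ ∞ (fun y => mollifier d n (x - y)) := by fun_prop
  have hcs : HasCompactSupport (fun y => mollifier d n (x - y)) :=
    (mollifier_hasCompactSupport n).comp_homeomorph (Homeomorph.subLeft x)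
  have hfφ : ∀ y, fderiv ℝ (fun y => mollifier d n (x - y)) y e
      = - fderiv ℝ (mollifier d n) (x - y) e := by
    intro y
    have h1 : HasFDerivAt (mollifier d n) (fderiv ℝ (mollifier d n) (x - y)) (x - y) :=
      (hρ.differentiable (by simp)).differentiableAt.hasFDerivAt
    have h2 : HasFDerivAt (fun y : Rd d => x - y) (-ContinuousLinearMap.id ℝ (Rd d)) y :=
      (hasFDerivAt_id y).const_sub x
    have h3 := (h1.comp y h2).fderiv
    simp only [Function.comp_def] at h3
    rw [h3]
    simp
  have key := hu.2.2 _ hφ hcs e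
  simp only [hfφ, mul_neg, integral_neg, neg_inj] at key
  rw [hfd, mollify_apply,
    ← integral_sub_left_eq_self (fun t => fderiv ℝ (mollifier d n) t e * u (x - t)) volume x,
    ← integral_sub_left_eq_self (fun t => mollifier d n t * inner ℝ (g (x - t)) e) volume x]
  simp only [sub_sub_cancel]
  simpa only [mul_comm] using key
end

/-! ### Calculus of weak gradients: chain rule and positive part -/

noncomputable section

open Filter Topology Convolution ContinuousLinearMap

variable {d : ℕ}

theorem MeasureTheory.LocallyIntegrable.integrable_mul_of_hasCompactSupport {f ψ : Rd d → ℝ}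
    (hf : LocallyIntegrable f) (hψ : Continuous ψ) (hc : HasCompactSupport ψ) :
    Integrable fun x => f x * ψ x := by
  simpa only [smul_eq_mul] using hf.integrable_smul_right_of_hasCompactSupport hψ hc

theorem MeasureTheory.LocallyIntegrable.norm_comp {E : Type*} [NormedAddCommGroup E]
    {f : Rd d → E} (hf : LocallyIntegrable f) : LocallyIntegrable fun x => ‖f x‖ :=
  hf.mono hf.aestronglyMeasurable.norm (Eventually.of_forall fun _ => (norm_norm _).le)

theorem MeasureTheory.LocallyIntegrable.inner_const' {g : Rd d → Rd d} (hg : LocallyIntegrable g)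
    (e : Rd d) : LocallyIntegrable fun x => (inner ℝ (g x) e : ℝ) := by
  refine (hg.norm_comp.smul ‖e‖).mono (hg.aestronglyMeasurable.inner aestronglyMeasurable_const)
    (Eventually.of_forall fun x => ?_)
  simp only [Pi.smul_apply, smul_eq_mul, norm_mul, norm_norm]
  exact (norm_inner_le_norm _ _).trans_eq (mul_comm _ _)

theorem continuous_fderiv_apply_of_contDiff {φ : Rd d → ℝ} (hφ : ContDiff ℝ ∞ φ) (e : Rd d) :
    Continuous fun x => fderiv ℝ φ x e :=
  (hφ.continuous_fderiv (by simp)).clm_apply continuous_const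

namespace HasWeakGradient

theorem congr {u v : Rd d → ℝ} {g h : Rd d → Rd d} (hu : HasWeakGradient u g)
    (huv : u =ᵐ[volume] v) (hgh : g =ᵐ[volume] h) : HasWeakGradient v h := by
  refine ⟨hu.1.congr huv, hu.2.1.congr hgh, fun φ hφ hc e => ?_⟩
  have h1 : ∫ x, v x * fderiv ℝ φ x e = ∫ x, u x * fderiv ℝ φ x e :=
    integral_congr_ae (by filter_upwards [huv] with x hx; rw [hx])
  have h2 : ∫ x, inner ℝ (h x) e * φ x = ∫ x, inner ℝ (g x) e * φ x :=
    integral_congr_ae (by filter_upwards [hgh] with x hx; rw [hx])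
  rw [h1, h2, hu.2.2 φ hφ hc e]

theorem add {u v : Rd d → ℝ} {g h : Rd d → Rd d} (hu : HasWeakGradient u g)
    (hv : HasWeakGradient v h) : HasWeakGradient (u + v) (g + h) := by
  refine ⟨hu.1.add hv.1, hu.2.1.add hv.2.1, fun φ hφ hc e => ?_⟩
  have hd := continuous_fderiv_apply_of_contDiff hφ e
  have hdc : HasCompactSupport fun x => fderiv ℝ φ x e := hc.fderiv_apply (𝕜 := ℝ) e
  simp only [Pi.add_apply, inner_add_left, add_mul]
  rw [integral_add (hu.1.integrable_mul_of_hasCompactSupport hd hdc)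
    (hv.1.integrable_mul_of_hasCompactSupport hd hdc),
    integral_add ((hu.2.1.inner_const' e).integrable_mul_of_hasCompactSupport hφ.continuous hc)
    ((hv.2.1.inner_const' e).integrable_mul_of_hasCompactSupport hφ.continuous hc),
    hu.2.2 φ hφ hc e, hv.2.2 φ hφ hc e]
  ring

theorem const_smul {u : Rd d → ℝ} {g : Rd d → Rd d} (hu : HasWeakGradient u g) (c : ℝ) :
    HasWeakGradient (c • u) (c • g) := by
  refine ⟨hu.1.smul c, hu.2.1.smul c, fun φ hφ hc e => ?_⟩
  simp only [Pi.smul_apply, smul_eq_mul, inner_smul_left, mul_assoc, integral_const_mul,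
    hu.2.2 φ hφ hc e]
  simp

theorem sub {u v : Rd d → ℝ} {g h : Rd d → Rd d} (hu : HasWeakGradient u g)
    (hv : HasWeakGradient v h) : HasWeakGradient (u - v) (g - h) := by
  have := hu.add (hv.const_smul (-1))
  simpa only [neg_smul, one_smul, ← sub_eq_add_neg] using this

/-- Weak gradients are unique up to null sets. -/
theorem unique {u : Rd d → ℝ} {g h : Rd d → Rd d} (hg : HasWeakGradient u g)
    (hh : HasWeakGradient u h) : g =ᵐ[volume] h := by
  refine ae_eq_of_integral_contDiff_smul_eq hg.2.1 hh.2.1 fun φ hφ hc => ?_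
  refine ext_inner_left ℝ fun e => ?_
  rw [← integral_inner (hg.2.1.integrable_smul_left_of_hasCompactSupport hφ.continuous hc),
    ← integral_inner (hh.2.1.integrable_smul_left_of_hasCompactSupport hφ.continuous hc)]
  have := (hg.2.2 φ hφ hc e).symm.trans (hh.2.2 φ hφ hc e)
  simp only [inner_smul_right, mul_comm (φ _)]
  simpa [real_inner_comm] using this

/-- The chain rule for smooth functions with derivative bounded by one. -/
theorem comp {u : Rd d → ℝ} {g : Rd d → Rd d} (hu : HasWeakGradient u g) {F F' : ℝ → ℝ}
    (hF : ∀ t, HasDerivAt F (F' t) t) (hF' : Continuous F') (hb : ∀ t, |F' t| ≤ 1) :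
    HasWeakGradient (fun x => F (u x)) (fun x => F' (u x) • g x) := by
  have hFc : Continuous F := continuous_iff_continuousAt.2 fun t => (hF t).continuousAt
  have hlip : ∀ s t, |F s - F t| ≤ |s - t| := fun s t => by
    have := convex_univ.norm_image_sub_le_of_norm_hasDerivWithin_le (f := F) (f' := F') (C := 1)
      (fun x _ => (hF x).hasDerivWithinAt) (fun x _ => hb x) (mem_univ t) (mem_univ s)
    simpa using this
  have hum := hu.1.aestronglyMeasurable
  have hFu : LocallyIntegrable fun x => F (u x) := by
    refine (hu.1.norm_comp.add (locallyIntegrable_const |F 0|)).mono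
      (hFc.comp_aestronglyMeasurable hum) (Eventually.of_forall fun x => ?_)
    have := hlip (u x) 0
    have h2 := abs_sub_abs_le_abs_sub (F (u x)) (F 0)
    simp only [Pi.add_apply, Real.norm_eq_abs, sub_zero] at *
    exact le_trans (by linarith) (le_abs_self _)
  have hF'm := hF'.comp_aestronglyMeasurable hum
  refine ⟨hFu, hu.2.1.mono (hF'm.smul hu.2.1.aestronglyMeasurable)
    (Eventually.of_forall fun x => ?_), fun φ hφ hc e => ?_⟩
  · rw [norm_smul]
    exact mul_le_of_le_one_left (norm_nonneg _) (hb _)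
  have hd := continuous_fderiv_apply_of_contDiff hφ e
  have hdc : HasCompactSupport fun x => fderiv ℝ φ x e := hc.fderiv_apply (𝕜 := ℝ) e
  set h : Rd d → ℝ := fun y => inner ℝ (g y) e with hh
  have hhl : LocallyIntegrable h := hu.2.1.inner_const' e
  have husm := mollify_contDiff hu.1
  have hhsm := mollify_contDiff hhl
  have hFun : ∀ n, Continuous fun x => F (mollify n u x) := fun n => hFc.comp (husm n).continuous
  have hF'un : ∀ n, Continuous fun x => F' (mollify n u x) := fun n =>
    hF'.comp (husm n).continuous
  -- For the smooth function `mollify n u` this is the classical chain rule and integration by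
  -- parts; the limit in `n` follows.
  have hparts : ∀ n, ∫ x, F (mollify n u x) * fderiv ℝ φ x e
      = - ∫ x, F' (mollify n u x) * mollify n h x * φ x := by
    intro n
    have hder : ∀ x, HasFDerivAt (fun x => F (mollify n u x))
        (F' (mollify n u x) • fderiv ℝ (mollify n u) x) x := fun x =>
      (hF _).comp_hasFDerivAt x ((husm n).differentiable (by simp)).differentiableAt.hasFDerivAt
    have hval : ∀ x, fderiv ℝ (fun x => F (mollify n u x)) x e
        = F' (mollify n u x) * mollify n h x := fun x => by
      rw [(hder x).fderiv, smul_apply, hu.fderiv_mollify, smul_eq_mul]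
    have := integral_mul_fderiv_eq_neg_fderiv_mul_of_integrable (μ := (volume : Measure (Rd d)))
      (f := fun x => F (mollify n u x)) (g := φ) (v := e) ?_ ?_ ?_
      (fun x _ => (hder x).differentiableAt)
      (fun x _ => (hφ.differentiable (by simp)).differentiableAt)
    · simpa only [hval] using this
    · simp only [hval]
      exact (((hF'un n).mul (hhsm n).continuous).mul hφ.continuous).integrable_of_hasCompactSupport
        hc.mul_left
    · exact ((hFun n).mul hd).integrable_of_hasCompactSupport hdc.mul_left
    · exact ((hFun n).mul hφ.continuous).integrable_of_hasCompactSupport hc.mul_left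
  have hlim1 : Tendsto (fun n => ∫ x, F (mollify n u x) * fderiv ℝ φ x e) atTop
      (𝓝 (∫ x, F (u x) * fderiv ℝ φ x e)) := by
    rw [tendsto_iff_norm_sub_tendsto_zero]
    refine squeeze_zero (fun _ => norm_nonneg _) (fun n => ?_)
      (integral_abs_mollify_sub_mul_tendsto hu.1 hd hdc)
    have hi := (husm n).continuous.locallyIntegrable.sub hu.1 |>.norm_comp
      |>.integrable_mul_of_hasCompactSupport hd.abs hdc.abs
    have hi' : Integrable fun x => F (mollify n u x) * fderiv ℝ φ x e :=
      ((hFun n).mul hd).integrable_of_hasCompactSupport hdc.mul_left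
    rw [← integral_sub hi' (hFu.integrable_mul_of_hasCompactSupport hd hdc)]
    refine (norm_integral_le_integral_norm _).trans
      (integral_mono_of_nonneg (Eventually.of_forall fun _ => norm_nonneg _) hi
        (Eventually.of_forall fun x => ?_))
    simp only [Real.norm_eq_abs, ← sub_mul, abs_mul]
    exact mul_le_mul_of_nonneg_right (hlip _ _) (abs_nonneg _)
  have hhφ := hhl.integrable_mul_of_hasCompactSupport hφ.continuous hc
  have hi1 : ∀ n, Integrable fun x => F' (mollify n u x) * (h x * φ x) := fun n =>
    hhφ.bdd_mul (hF'un n).aestronglyMeasurable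
      (Eventually.of_forall fun x => hb _)
  have hlim2 : Tendsto (fun n => ∫ x, F' (mollify n u x) * (h x * φ x)) atTop
      (𝓝 (∫ x, F' (u x) * (h x * φ x))) := by
    refine tendsto_integral_of_dominated_convergence (fun x => ‖h x * φ x‖)
      (fun n => (hi1 n).aestronglyMeasurable) hhφ.norm
      (fun n => Eventually.of_forall fun x => ?_) ?_
    · rw [norm_mul]
      exact mul_le_of_le_one_left (norm_nonneg _) (hb _)
    · filter_upwards [mollify_tendsto_ae hu.1] with x hx
      exact ((hF'.tendsto _).comp hx).mul_const _
  have hi2 : ∀ n, Integrable fun x => F' (mollify n u x) * mollify n h x * φ x := fun n =>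
    (((hF'un n).mul (hhsm n).continuous).mul hφ.continuous).integrable_of_hasCompactSupport
        hc.mul_left
  -- Both factors vary with `n`: replacing `mollify n h` by `h` costs an `L¹_loc` error since `|F'|
  -- ≤ 1`, and the remaining limit is the dominated one above.
  have hlim3 : Tendsto (fun n => ∫ x, F' (mollify n u x) * mollify n h x * φ x) atTop
      (𝓝 (∫ x, F' (u x) * (h x * φ x))) := by
    have hz : Tendsto (fun n => (∫ x, F' (mollify n u x) * mollify n h x * φ x)
        - ∫ x, F' (mollify n u x) * (h x * φ x)) atTop (𝓝 0) := by
      rw [tendsto_zero_iff_norm_tendsto_zero]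
      refine squeeze_zero (fun _ => norm_nonneg _) (fun n => ?_)
        (integral_abs_mollify_sub_mul_tendsto hhl hφ.continuous hc)
      have hi := (hhsm n).continuous.locallyIntegrable.sub hhl |>.norm_comp
        |>.integrable_mul_of_hasCompactSupport hφ.continuous.abs hc.abs
      rw [← integral_sub (hi2 n) (hi1 n)]
      refine (norm_integral_le_integral_norm _).trans
        (integral_mono_of_nonneg (Eventually.of_forall fun _ => norm_nonneg _) hi
          (Eventually.of_forall fun x => ?_))
      have e1 : F' (mollify n u x) * mollify n h x * φ x - F' (mollify n u x) * (h x * φ x)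
        = F' (mollify n u x) * ((mollify n h x - h x) * φ x) := by ring
      simp only [Real.norm_eq_abs, e1, abs_mul]
      exact mul_le_of_le_one_left (by positivity) (hb _)
    simpa using hz.add hlim2
  have hfin := tendsto_nhds_unique hlim1 ((hlim3.neg).congr fun n => (hparts n).symm)
  rw [hfin]
  congr 1
  refine integral_congr_ae (Eventually.of_forall fun x => ?_)
  simp only [hh, inner_smul_left, mul_assoc]
  rfl

/-- Passage to the limit in the chain rule. -/
theorem of_tendsto {u : Rd d → ℝ} {g : Rd d → Rd d} (hu : LocallyIntegrable u)
    (hgl : LocallyIntegrable g) {F F' : ℕ → ℝ → ℝ} {G H : ℝ → ℝ}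
    (h : ∀ n, HasWeakGradient (fun x => F n (u x)) (fun x => F' n (u x) • g x))
    {C : ℝ} (hFb : ∀ n t, |F n t| ≤ |t| + C) (hF'b : ∀ n t, |F' n t| ≤ 1)
    (hF : ∀ t, Tendsto (fun n => F n t) atTop (𝓝 (G t)))
    (hF' : ∀ t, Tendsto (fun n => F' n t) atTop (𝓝 (H t))) :
    HasWeakGradient (fun x => G (u x)) (fun x => H (u x) • g x) := by
  have hGm : AEStronglyMeasurable (fun x => G (u x)) :=
    aestronglyMeasurable_of_tendsto_ae atTop (fun n => (h n).1.aestronglyMeasurable)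
      (Eventually.of_forall fun x => hF (u x))
  have hHm : AEStronglyMeasurable (fun x => H (u x) • g x) :=
    aestronglyMeasurable_of_tendsto_ae atTop (fun n => (h n).2.1.aestronglyMeasurable)
      (Eventually.of_forall fun x => (hF' (u x)).smul_const (g x))
  have hGb : ∀ t, |G t| ≤ |t| + C := fun t => le_of_tendsto' (hF t).abs fun n => hFb n t
  have hHb : ∀ t, |H t| ≤ 1 := fun t => le_of_tendsto' (hF' t).abs fun n => hF'b n t
  have hbd : LocallyIntegrable fun x => |u x| + C := hu.norm_comp.add (locallyIntegrable_const C)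
  refine ⟨hbd.mono hGm (Eventually.of_forall fun x => (hGb _).trans (le_abs_self _)),
    hgl.mono hHm (Eventually.of_forall fun x => ?_), fun φ hφ hc e => ?_⟩
  · rw [norm_smul]
    exact mul_le_of_le_one_left (norm_nonneg _) (hHb _)
  have hd := continuous_fderiv_apply_of_contDiff hφ e
  have hdc : HasCompactSupport fun x => fderiv ℝ φ x e := hc.fderiv_apply (𝕜 := ℝ) e
  have l1 : Tendsto (fun n => ∫ x, F n (u x) * fderiv ℝ φ x e) atTop
      (𝓝 (∫ x, G (u x) * fderiv ℝ φ x e)) := by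
    refine tendsto_integral_of_dominated_convergence (fun x => (|u x| + C) * |fderiv ℝ φ x e|)
      (fun n => ((h n).1.integrable_mul_of_hasCompactSupport hd hdc).aestronglyMeasurable)
      (hbd.integrable_mul_of_hasCompactSupport hd.abs hdc.abs)
      (fun n => Eventually.of_forall fun x => ?_)
      (Eventually.of_forall fun x => (hF _).mul_const _)
    rw [norm_mul]
    exact mul_le_mul_of_nonneg_right (hFb _ _) (abs_nonneg _)
  have l2 : Tendsto (fun n => ∫ x, inner ℝ (F' n (u x) • g x) e * φ x) atTop
      (𝓝 (∫ x, inner ℝ (H (u x) • g x) e * φ x)) := by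
    refine tendsto_integral_of_dominated_convergence (fun x => ‖inner ℝ (g x) e * φ x‖)
      (fun n => (((h n).2.1.inner_const' e).integrable_mul_of_hasCompactSupport
        hφ.continuous hc).aestronglyMeasurable)
      ((hgl.inner_const' e).integrable_mul_of_hasCompactSupport hφ.continuous hc).norm
      (fun n => Eventually.of_forall fun x => ?_)
      (Eventually.of_forall fun x =>
        (((hF' _).smul_const (g x)).inner tendsto_const_nhds).mul_const _)
    rw [real_inner_smul_left, mul_assoc, norm_mul]
    exact mul_le_of_le_one_left (norm_nonneg _) (hF'b _ _)
  exact tendsto_nhds_unique l1 (l2.neg.congr fun n => ((h n).2.2 φ hφ hc e).symm)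

/-- The weak gradient vanishes almost everywhere on the zero set. -/
theorem ae_eq_zero_on_zeros {u : Rd d → ℝ} {g : Rd d → Rd d} (hu : HasWeakGradient u g) :
    ∀ᵐ x, u x = 0 → g x = 0 := by
  have hpos : ∀ n : ℕ, (0 : ℝ) < (n : ℝ) + 1 := fun n => by positivity
  have hone : ∀ (n : ℕ) (t : ℝ), 1 ≤ 1 + (((n : ℝ) + 1) * t) ^ 2 := fun n t => by
    nlinarith [sq_nonneg (((n : ℝ) + 1) * t)]
  -- The functions `arctan ((n + 1) t) / (n + 1)` tend to 0 while their derivatives tend to the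
  -- indicator of `{0}`. So `g` cut off to `{u = 0}` is a weak gradient of the zero function.
  have key : HasWeakGradient (fun x => (fun _ : ℝ => (0 : ℝ)) (u x))
      (fun x => (fun t : ℝ => if t = 0 then (1 : ℝ) else 0) (u x) • g x) := by
    refine of_tendsto hu.1 hu.2.1 (C := Real.pi / 2)
      (G := fun _ => 0) (H := fun t => if t = 0 then 1 else 0)
      (F := fun n t => Real.arctan (((n : ℝ) + 1) * t) / ((n : ℝ) + 1))
      (F' := fun n t => 1 / (1 + (((n : ℝ) + 1) * t) ^ 2)) (fun n => ?_) (fun n t => ?_)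
      (fun n t => ?_) (fun t => ?_) (fun t => ?_)
    · refine hu.comp (F := fun t => Real.arctan (((n : ℝ) + 1) * t) / ((n : ℝ) + 1))
        (F' := fun t => 1 / (1 + (((n : ℝ) + 1) * t) ^ 2)) (fun t => ?_) ?_ (fun t => ?_)
      · have h1 := ((hasDerivAt_id t).const_mul ((n : ℝ) + 1)).arctan.div_const ((n : ℝ) + 1)
        refine h1.congr_deriv ?_
        have := (hpos n).ne'
        simp only [id]
        field_simp
      · refine continuous_const.div (by fun_prop) fun t => ?_
        linarith [hone n t]
      · rw [abs_of_nonneg (by positivity), div_le_one (by positivity)]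
        exact hone n t
    · rw [abs_div, abs_of_pos (hpos n)]
      have h1 : |Real.arctan (((n : ℝ) + 1) * t)| ≤ Real.pi / 2 :=
        abs_le.2 ⟨(Real.neg_pi_div_two_lt_arctan _).le, (Real.arctan_lt_pi_div_two _).le⟩
      have h2 : |Real.arctan (((n : ℝ) + 1) * t)| / ((n : ℝ) + 1) ≤
          |Real.arctan (((n : ℝ) + 1) * t)| :=
        div_le_self (abs_nonneg _) (by linarith [n.cast_nonneg (α := ℝ)])
      linarith [abs_nonneg t]
    · rw [abs_of_nonneg (by positivity), div_le_one (by positivity)]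
      exact hone n t
    · have h1 : Tendsto (fun n : ℕ => Real.pi / 2 * (1 / ((n : ℝ) + 1))) atTop (𝓝 0) := by
        simpa using tendsto_one_div_add_atTop_nhds_zero_nat.const_mul (Real.pi / 2)
      refine squeeze_zero_norm (fun n => ?_) h1
      rw [norm_div, Real.norm_of_nonneg (hpos n).le, mul_one_div]
      gcongr
      exact abs_le.2 ⟨(Real.neg_pi_div_two_lt_arctan _).le, (Real.arctan_lt_pi_div_two _).le⟩
    · by_cases ht : t = 0
      · simp [ht]
      · simp only [ht, if_false, one_div]
        refine tendsto_inv_atTop_zero.comp (tendsto_atTop_add_const_left _ _ ?_)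
        simp only [mul_pow]
        refine Tendsto.atTop_mul_const (by positivity) ?_
        exact (tendsto_pow_atTop two_ne_zero).comp
          (tendsto_atTop_add_const_right _ _ tendsto_natCast_atTop_atTop)
  have hz : HasWeakGradient (fun _ : Rd d => (0 : ℝ)) (fun _ => 0) := by
    have := hu.const_smul 0
    rw [zero_smul, zero_smul] at this
    exact this
  filter_upwards [key.unique hz] with x hx hux
  simpa [hux] using hx

/-- The weak gradient of the absolute value. -/
theorem abs {u : Rd d → ℝ} {g : Rd d → Rd d} (hu : HasWeakGradient u g) :
    HasWeakGradient (fun x => |u x|) (fun x => Real.sign (u x) • g x) := by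
  have hpos : ∀ n : ℕ, (0 : ℝ) < 1 / ((n : ℝ) + 1) := fun n => by positivity
  have hroot : ∀ (n : ℕ) (t : ℝ), 0 < t ^ 2 + (1 / ((n : ℝ) + 1)) ^ 2 := fun n t => by
    have := hpos n
    positivity
  have hle : ∀ (n : ℕ) (t : ℝ), |t| ≤ √(t ^ 2 + (1 / ((n : ℝ) + 1)) ^ 2) := fun n t =>
    Real.abs_le_sqrt (by nlinarith [hpos n])
  have hb : ∀ (n : ℕ) (t : ℝ), |t / √(t ^ 2 + (1 / ((n : ℝ) + 1)) ^ 2)| ≤ 1 := fun n t => by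
    have := Real.sqrt_pos.2 (hroot n t)
    rw [abs_div, abs_of_pos this, div_le_one this]
    exact hle n t
  have hlim : ∀ t : ℝ, Tendsto (fun n : ℕ => √(t ^ 2 + (1 / ((n : ℝ) + 1)) ^ 2)) atTop
      (𝓝 |t|) := fun t => by
    have h1 := (tendsto_one_div_add_atTop_nhds_zero_nat (𝕜 := ℝ)).pow 2 |>.const_add (t ^ 2)
    have h2 := (Real.continuous_sqrt.tendsto _).comp h1
    rw [← Real.sqrt_sq_eq_abs]
    simpa [Function.comp_def] using h2
  -- Regularize `|t|` by `√(t² + ε²)`, whose derivative vanishes at 0, in agreement with `Real.sign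
  -- 0 = 0`.
  refine of_tendsto hu.1 hu.2.1 (C := 1) (G := fun t => |t|) (H := Real.sign)
      (F := fun n t => √(t ^ 2 + (1 / ((n : ℝ) + 1)) ^ 2))
      (F' := fun n t => t / √(t ^ 2 + (1 / ((n : ℝ) + 1)) ^ 2)) (fun n => ?_) (fun n t => ?_)
      hb hlim (fun t => ?_)
  · refine hu.comp (F := fun t => √(t ^ 2 + (1 / ((n : ℝ) + 1)) ^ 2))
      (F' := fun t => t / √(t ^ 2 + (1 / ((n : ℝ) + 1)) ^ 2)) (fun t => ?_) ?_ (hb n)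
    · have h1 := ((hasDerivAt_pow 2 t).add_const ((1 / ((n : ℝ) + 1)) ^ 2)).sqrt (hroot n t).ne'
      refine h1.congr_deriv ?_
      have := (Real.sqrt_pos.2 (hroot n t)).ne'
      field_simp
      ring
    · exact continuous_id.div (by fun_prop) fun t => (Real.sqrt_pos.2 (hroot n t)).ne'
  · rw [abs_of_nonneg (Real.sqrt_nonneg _)]
    have h1 : 1 / ((n : ℝ) + 1) ≤ 1 := by
      rw [div_le_one (by positivity)]
      linarith [n.cast_nonneg (α := ℝ)]
    apply Real.sqrt_le_iff.2
    refine ⟨by positivity, ?_⟩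
    nlinarith [abs_nonneg t, sq_abs t, hpos n]
  · rcases lt_trichotomy t 0 with ht | ht | ht
    · rw [Real.sign_of_neg ht]
      have := (tendsto_const_nhds (x := t)).div (hlim t) (abs_pos.2 ht.ne).ne'
      rwa [abs_of_neg ht, div_neg, div_self ht.ne] at this
    · simp [ht]
    · rw [Real.sign_of_pos ht]
      have := (tendsto_const_nhds (x := t)).div (hlim t) (abs_pos.2 ht.ne').ne'
      rwa [abs_of_pos ht, div_self ht.ne'] at this

/-- The weak gradient of the positive part. -/
theorem posPart {u : Rd d → ℝ} {g : Rd d → Rd d} (hu : HasWeakGradient u g) :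
    HasWeakGradient (fun x => max (u x) 0) ({x | 0 < u x}.indicator g) := by
  refine ((hu.add hu.abs).const_smul (1 / 2)).congr (Eventually.of_forall fun x => ?_) ?_
  · simp only [Pi.smul_apply, Pi.add_apply, smul_eq_mul]
    rcases le_total 0 (u x) with h | h
    · rw [abs_of_nonneg h, max_eq_left h]
      ring
    · rw [abs_of_nonpos h, max_eq_right h]
      ring
  -- On `{u = 0}` averaging the two gradients gives `g / 2`, the indicator gives 0; they agree
  -- because `g` vanishes there a.e.
  · filter_upwards [hu.ae_eq_zero_on_zeros] with x hx
    simp only [Pi.smul_apply, Pi.add_apply]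
    rcases lt_trichotomy (u x) 0 with h | h | h
    · rw [Real.sign_of_neg h, indicator_of_notMem (by simp [h.le])]
      simp
    · rw [hx h, indicator_of_notMem (by simp [h])]
      simp
    · rw [Real.sign_of_pos h, indicator_of_mem (by simpa using h), one_smul, ← two_smul ℝ (g x),
        smul_smul]
      norm_num

end HasWeakGradient
end

/-! ### Sobolev functions -/

noncomputable section

open Filter Topology Convolution ContinuousLinearMap

variable {d : ℕ} {p : ℝ}

/-- Uniqueness a.e. makes the choice in `weakGrad` harmless. -/
theorem HasWeakGradient.weakGrad_ae_eq {u : Rd d → ℝ} {g : Rd d → Rd d}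
    (hu : HasWeakGradient u g) : weakGrad u =ᵐ[volume] g := by
  have h : ∃ g, HasWeakGradient u g := ⟨g, hu⟩
  rw [weakGrad, dif_pos h]
  exact h.choose_spec.unique hu

namespace MemW1p

theorem hasWeakGradient {u : Rd d → ℝ} (hu : MemW1p p u) : HasWeakGradient u (weakGrad u) := by
  obtain ⟨_, g, hg, _⟩ := hu
  exact hg.congr (ae_eq_refl _) hg.weakGrad_ae_eq.symm

theorem memLp_weakGrad {u : Rd d → ℝ} (hu : MemW1p p u) :
    MemLp (weakGrad u) (ENNReal.ofReal p) volume := by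
  obtain ⟨_, g, hg, hgp⟩ := hu
  exact hgp.ae_eq hg.weakGrad_ae_eq.symm

theorem add {u v : Rd d → ℝ} (hu : MemW1p p u) (hv : MemW1p p v) : MemW1p p (u + v) :=
  ⟨hu.1.add hv.1, _, hu.hasWeakGradient.add hv.hasWeakGradient,
    hu.memLp_weakGrad.add hv.memLp_weakGrad⟩

theorem sub {u v : Rd d → ℝ} (hu : MemW1p p u) (hv : MemW1p p v) : MemW1p p (u - v) :=
  ⟨hu.1.sub hv.1, _, hu.hasWeakGradient.sub hv.hasWeakGradient,
    hu.memLp_weakGrad.sub hv.memLp_weakGrad⟩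

theorem posPart {u : Rd d → ℝ} (hu : MemW1p p u) : MemW1p p (fun x => max (u x) 0) := by
  have h := hu.hasWeakGradient.posPart
  refine ⟨hu.1.mono h.1.aestronglyMeasurable (Eventually.of_forall fun x => ?_), _, h,
    hu.memLp_weakGrad.mono h.2.1.aestronglyMeasurable (Eventually.of_forall fun x => ?_)⟩
  · rw [Real.norm_of_nonneg (le_max_right _ _)]
    exact max_le (le_abs_self _) (norm_nonneg _)
  · exact norm_indicator_le_norm_self _ _

theorem weakGrad_add {u v : Rd d → ℝ} (hu : MemW1p p u) (hv : MemW1p p v) :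
    weakGrad (u + v) =ᵐ[volume] weakGrad u + weakGrad v :=
  (hu.hasWeakGradient.add hv.hasWeakGradient).weakGrad_ae_eq

theorem weakGrad_sub {u v : Rd d → ℝ} (hu : MemW1p p u) (hv : MemW1p p v) :
    weakGrad (u - v) =ᵐ[volume] weakGrad u - weakGrad v :=
  (hu.hasWeakGradient.sub hv.hasWeakGradient).weakGrad_ae_eq

theorem weakGrad_posPart {u : Rd d → ℝ} (hu : MemW1p p u) :
    weakGrad (fun x => max (u x) 0) =ᵐ[volume] {x | 0 < u x}.indicator (weakGrad u) :=
  hu.hasWeakGradient.posPart.weakGrad_ae_eq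

/-- A Sobolev function with vanishing gradient is zero. -/
theorem ae_eq_zero_of_weakGrad_ae_eq_zero (hd : 1 ≤ d) (hp : 1 < p) {u : Rd d → ℝ}
    (hu : MemW1p p u) (hg : weakGrad u =ᵐ[volume] 0) : u =ᵐ[volume] 0 := by
  have hwg : HasWeakGradient u 0 := hu.hasWeakGradient.congr (ae_eq_refl _) hg
  have hconst : ∀ n x, mollify n u x = mollify n u 0 := fun n x => by
    refine is_const_of_fderiv_eq_zero (𝕜 := ℝ)
      ((mollify_contDiff hwg.1 n).differentiable (by simp)) (fun y => ?_) x 0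
    ext e
    rw [hwg.fderiv_mollify, mollify_apply]
    simp
  have hlim := mollify_tendsto_ae hwg.1
  obtain ⟨x₀, hx₀⟩ := hlim.exists
  have huc : u =ᵐ[volume] fun _ => u x₀ := by
    filter_upwards [hlim] with x hx
    exact tendsto_nhds_unique hx (hx₀.congr fun n => by rw [hconst n x, hconst n x₀])
  -- Since `d ≥ 1`, the whole space has infinite measure, so the only constant in `L^p` is 0.
  have hc := (memLp_const_iff (ENNReal.ofReal_pos.2 (by linarith)).ne' ENNReal.ofReal_ne_top).1
    (hu.1.ae_eq huc)
  have : Nonempty (Fin d) := ⟨0, hd⟩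
  have : Nontrivial (Rd d) := inferInstance
  have : NoncompactSpace (Rd d) := NormedSpace.noncompactSpace ℝ (Rd d)
  rw [measure_univ_of_isAddLeftInvariant] at hc
  filter_upwards [huc] with x hx
  simpa [hx] using hc

end MemW1p

/-! ### Capacity and quasi-continuity -/

theorem pCapacity_mono {A B : Set (Rd d)} (h : A ⊆ B) : pCapacity p A ≤ pCapacity p B :=
  iInf_mono fun _ => iInf_mono fun _ => iInf_mono' fun ⟨U, hU, hBU, hu⟩ =>
    ⟨⟨U, hU, h.trans hBU, hu⟩, le_rfl⟩

/-- The energy density in the definition of the capacity is measurable. -/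
theorem MemW1p.aemeasurable_energy {u : Rd d → ℝ} (hu : MemW1p p u) :
    AEMeasurable fun x => ENNReal.ofReal (|u x| ^ p) + ENNReal.ofReal (‖weakGrad u x‖ ^ p) := by
  have h1 : AEMeasurable fun x => |u x| := hu.1.1.norm.aemeasurable
  have h2 : AEMeasurable fun x => ‖weakGrad u x‖ := hu.memLp_weakGrad.1.norm.aemeasurable
  exact (h1.pow_const p).ennreal_ofReal.add (h2.pow_const p).ennreal_ofReal

/-- The capacity is subadditive. -/
theorem pCapacity_union_le (A B : Set (Rd d)) :
    pCapacity p (A ∪ B) ≤ pCapacity p A + pCapacity p B := by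
  simp only [pCapacity, ENNReal.iInf_add, ENNReal.add_iInf]
  refine le_iInf fun u => le_iInf fun hu => le_iInf fun ⟨U, hU, hBU, hu1⟩ =>
    le_iInf fun v => le_iInf fun hv => le_iInf fun ⟨W, hW, hAW, hv1⟩ => ?_
  -- This is `max u v`; a.e. its energy density is that of `u` or that of `v`, hence at most their
  -- sum.
  set w : Rd d → ℝ := u + fun x => max ((v - u) x) 0 with hw
  have hwval : ∀ x, w x = max (u x) (v x) := fun x => by
    simp only [hw, Pi.add_apply, Pi.sub_apply]
    rw [← max_add_add_left]
    simp [max_comm]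
  have hwm : MemW1p p w := hu.add (hv.sub hu).posPart
  have hadm : ∃ O : Set (Rd d), IsOpen O ∧ A ∪ B ⊆ O ∧ ∀ᵐ x ∂volume, x ∈ O → 1 ≤ w x := by
    refine ⟨U ∪ W, hU.union hW, union_subset (hAW.trans subset_union_right)
      (hBU.trans subset_union_left), ?_⟩
    filter_upwards [hu1, hv1] with x h1 h2 hx
    rw [hwval]
    rcases hx with hx | hx
    · exact (h1 hx).trans (le_max_left _ _)
    · exact (h2 hx).trans (le_max_right _ _)
  refine iInf_le_of_le w (iInf_le_of_le hwm (iInf_le_of_le hadm ?_))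
  rw [add_comm, ← lintegral_add_left' hu.aemeasurable_energy]
  refine lintegral_mono_ae ?_
  filter_upwards [hu.weakGrad_add (hv.sub hu).posPart, (hv.sub hu).weakGrad_posPart,
    hv.weakGrad_sub hu] with x h1 h2 h3
  rw [hwval, h1, Pi.add_apply, h2]
  by_cases hx : 0 < (v - u) x
  · rw [indicator_of_mem (by exact hx), h3, Pi.sub_apply, add_sub_cancel]
    simp only [Pi.sub_apply, sub_pos] at hx
    rw [max_eq_right hx.le]
    exact le_add_self
  · rw [indicator_of_notMem (by exact hx), add_zero]
    simp only [Pi.sub_apply, sub_pos, not_lt] at hx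
    rw [max_eq_left hx]
    exact le_self_add

/-- Every competitor has `|u| ^ p ≥ 1` a.e. on a neighbourhood of `A`. This is what turns q.e.
statements into a.e. ones. -/
theorem volume_le_pCapacity (hp : 1 < p) (A : Set (Rd d)) : volume A ≤ pCapacity p A := by
  refine le_iInf fun u => le_iInf fun hu => le_iInf fun ⟨U, hU, hAU, hu1⟩ => ?_
  calc volume A ≤ volume U := measure_mono hAU
    _ = ∫⁻ x, U.indicator 1 x := (lintegral_indicator_one hU.measurableSet).symm
    _ ≤ _ := by
      refine lintegral_mono_ae ?_
      filter_upwards [hu1] with x hx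
      by_cases hxU : x ∈ U
      · rw [indicator_of_mem hxU, Pi.one_apply]
        refine le_add_right ?_
        rw [← ENNReal.ofReal_one]
        refine ENNReal.ofReal_le_ofReal (Real.one_le_rpow ?_ (by linarith))
        exact (hx hxU).trans (le_abs_self _)
      · simp [hxU]

theorem QuasiEverywhere.mono {P Q : Rd d → Prop} (h : QuasiEverywhere p P)
    (hPQ : ∀ x, P x → Q x) : QuasiEverywhere p Q :=
  le_antisymm ((pCapacity_mono fun x (hx : ¬ Q x) (hP : P x) => hx (hPQ x hP)).trans_eq h) bot_le

theorem QuasiEverywhere.and {P Q : Rd d → Prop} (hP : QuasiEverywhere p P)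
    (hQ : QuasiEverywhere p Q) : QuasiEverywhere p fun x => P x ∧ Q x := by
  refine le_antisymm ?_ bot_le
  have h : {x | ¬ (P x ∧ Q x)} ⊆ {x | ¬ P x} ∪ {x | ¬ Q x} := fun x hx => by
    by_contra hcon
    simp only [mem_union, mem_ofPred_eq, not_or, not_not] at hcon
    exact hx hcon
  refine (pCapacity_mono h).trans ((pCapacity_union_le _ _).trans_eq ?_)
  rw [show pCapacity p {x | ¬ P x} = 0 from hP, show pCapacity p {x | ¬ Q x} = 0 from hQ, add_zero]

theorem QuasiEverywhere.ae (hp : 1 < p) {P : Rd d → Prop} (h : QuasiEverywhere p P) :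
    ∀ᵐ x, P x :=
  le_antisymm ((volume_le_pCapacity hp _).trans_eq h) bot_le

namespace QuasiContinuous

theorem sub {u v : Rd d → ℝ} (hu : QuasiContinuous p u) (hv : QuasiContinuous p v) :
    QuasiContinuous p (u - v) := by
  intro ε hε
  obtain ⟨G, hG, hGc, hGu⟩ := hu (ε / 2) (ENNReal.half_pos hε.ne')
  obtain ⟨H, hH, hHc, hHv⟩ := hv (ε / 2) (ENNReal.half_pos hε.ne')
  refine ⟨G ∪ H, hG.union hH, ?_, ?_⟩
  · calc pCapacity p (G ∪ H) ≤ pCapacity p G + pCapacity p H := pCapacity_union_le _ _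
      _ < ε / 2 + ε / 2 := ENNReal.add_lt_add hGc hHc
      _ = ε := ENNReal.add_halves ε
  · exact (hGu.mono (compl_subset_compl.2 subset_union_left)).sub
      (hHv.mono (compl_subset_compl.2 subset_union_right))

theorem posPart {u : Rd d → ℝ} (hu : QuasiContinuous p u) :
    QuasiContinuous p (fun x => max (u x) 0) := fun ε hε =>
  let ⟨G, hG, hGc, hGu⟩ := hu ε hε
  ⟨G, hG, hGc, hGu.sup continuousOn_const⟩

/-- Quasi-continuous functions are measurable for measures that do not charge polar sets. -/
theorem aestronglyMeasurable {u : Rd d → ℝ} (hu : QuasiContinuous p u) {μ : Measure (Rd d)}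
    (hμ : IsCapacitary p μ) : AEStronglyMeasurable u μ := by
  -- The exceptional sets intersect in a set of zero capacity, which is `μ`-null; off it, countably
  -- many closed sets carry continuous restrictions of `u`.
  choose G hG hGc hGu using fun n : ℕ => hu ((n : ℝ≥0∞) + 1)⁻¹ (by simp)
  have hcap : pCapacity p (⋂ n, G n) = 0 := by
    have hlim : Tendsto (fun n : ℕ => ((n : ℝ≥0∞) + 1)⁻¹) atTop (𝓝 0) := by
      simpa using (tendsto_add_atTop_iff_nat 1).2 ENNReal.tendsto_inv_nat_nhds_zero
    exact le_antisymm (ge_of_tendsto' hlim fun n =>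
      (pCapacity_mono (iInter_subset _ n)).trans (hGc n).le) bot_le
  have hnull : μ (⋂ n, G n) = 0 :=
    hμ.1 _ (MeasurableSet.iInter fun n => (hG n).measurableSet) hcap
  have hres : μ.restrict (⋃ n, (G n)ᶜ) = μ := by
    refine Measure.restrict_eq_self_of_ae_mem ?_
    have := measure_eq_zero_iff_ae_notMem.1 hnull
    filter_upwards [this] with x hx
    rwa [← compl_iInter]
  rw [← hres]
  exact (aemeasurable_iUnion_iff.2 fun n =>
    (hGu n).aemeasurable (hG n).isClosed_compl.measurableSet).aestronglyMeasurable

/-- A quasi-continuous function vanishing almost everywhere vanishes quasi-everywhere. -/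
theorem quasiEverywhere_eq_zero {u : Rd d → ℝ} (hu : QuasiContinuous p u)
    (h0 : u =ᵐ[volume] 0) : QuasiEverywhere p fun x => u x = 0 := by
  refine le_antisymm (ENNReal.le_of_forall_pos_le_add fun ε hε _ => ?_) bot_le
  rw [zero_add]
  obtain ⟨G, hG, hGc, hGu⟩ := hu ε (by exact_mod_cast hε)
  refine le_trans ?_ hGc.le
  -- `{u ≠ 0}` is relatively open off `G`, so `G ∪ O` is an open neighbourhood of it that exceeds
  -- `G` by a Lebesgue-null set. Competitors for `G` are thus competitors for `{u ≠ 0}`.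
  obtain ⟨O, hO, hOe⟩ := continuousOn_iff'.1 hGu {0}ᶜ isOpen_compl_singleton
  refine iInf_mono fun v => iInf_mono fun _ => iInf_mono' fun ⟨W, _, hGW, hv⟩ =>
    ⟨⟨G ∪ O, hG.union hO, fun x hx => ?_, ?_⟩, le_rfl⟩
  · by_cases hxG : x ∈ G
    · exact Or.inl hxG
    · exact Or.inr (hOe.subset ⟨hx, hxG⟩).1
  · filter_upwards [hv, h0] with x hx hx0 hxGO
    by_cases hxG : x ∈ G
    · exact hx (hGW hxG)
    · exact absurd hx0 (hOe.symm.subset ⟨hxGO.resolve_left hxG, hxG⟩).1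

end QuasiContinuous

theorem sub_mem_sobolev {u v : Rd d → ℝ} (hu : u ∈ sobolev d p) (hv : v ∈ sobolev d p) :
    u - v ∈ sobolev d p :=
  ⟨hu.1.sub hv.1, hu.2.sub hv.2⟩

theorem posPart_mem_sobolev {u : Rd d → ℝ} (hu : u ∈ sobolev d p) :
    (fun x => max (u x) 0) ∈ sobolev d p :=
  ⟨hu.1.posPart, hu.2.posPart⟩

theorem sub_mem_sobolevZero {D : Set (Rd d)} {u v : Rd d → ℝ} (hu : u ∈ sobolevZero p D)
    (hv : v ∈ sobolevZero p D) : u - v ∈ sobolevZero p D :=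
  ⟨sub_mem_sobolev hu.1 hv.1, (hu.2.and hv.2).mono fun x hx hxD => by
    simp [hx.1 hxD, hx.2 hxD]⟩

theorem posPart_mem_sobolevZero {D : Set (Rd d)} {u : Rd d → ℝ} (hu : u ∈ sobolevZero p D) :
    (fun x => max (u x) 0) ∈ sobolevZero p D :=
  ⟨posPart_mem_sobolev hu.1, hu.2.mono fun x hx hxD => by simp [hx hxD]⟩

/-- A function of `W^{1,p}_0(D)` whose gradient vanishes in `D` is zero. -/
theorem quasiEverywhere_eq_zero_of_mem_sobolevZero (hd : 1 ≤ d) (hp : 1 < p) {D : Set (Rd d)}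
    {u : Rd d → ℝ} (hu : u ∈ sobolevZero p D) (hg : ∀ᵐ x, x ∈ D → weakGrad u x = 0) :
    QuasiEverywhere p fun x => u x = 0 := by
  refine hu.1.2.quasiEverywhere_eq_zero
    (hu.1.1.ae_eq_zero_of_weakGrad_ae_eq_zero hd hp ?_)
  filter_upwards [hg, hu.2.ae hp, hu.1.1.hasWeakGradient.ae_eq_zero_on_zeros] with x h1 h2 h3
  by_cases hx : x ∈ D
  · exact h1 hx
  · exact h3 (h2 hx)
end

/-! ### Monotonicity of the p-Laplacian nonlinearity -/

noncomputable section

open Filter Topology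

section Monotonicity

variable {E : Type*} [NormedAddCommGroup E] [InnerProductSpace ℝ E] {p : ℝ}

/-- Splits the monotonicity expression into a radial part and a multiple of the Cauchy–Schwarz
defect. Each is nonnegative, for all `p > 1` at once. -/
theorem pLaplace_monotone_aux (hp : 1 < p) (a b : E) :
    (‖a‖ ^ (p - 1) - ‖b‖ ^ (p - 1)) * (‖a‖ - ‖b‖)
        + (‖a‖ ^ (p - 2) + ‖b‖ ^ (p - 2)) * (‖a‖ * ‖b‖ - inner ℝ a b)
      = ‖a‖ ^ (p - 2) * inner ℝ a (a - b) - ‖b‖ ^ (p - 2) * inner ℝ b (a - b) := by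
  have key : ∀ s t : ℝ, 0 ≤ s → s ^ (p - 1) * t = s ^ (p - 2) * s * t := fun s t hs => by
    rcases hs.eq_or_lt with rfl | hs
    · simp [(by linarith : p - 1 ≠ 0)]
    · rw [show p - 1 = p - 2 + 1 by ring, Real.rpow_add hs, Real.rpow_one]
  rw [sub_mul, mul_sub, mul_sub, key _ _ (norm_nonneg a), key _ _ (norm_nonneg a),
    key _ _ (norm_nonneg b), key _ _ (norm_nonneg b), inner_sub_right, inner_sub_right,
    real_inner_self_eq_norm_sq, real_inner_self_eq_norm_sq, real_inner_comm a b]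
  ring

theorem rpow_sub_mul_sub_nonneg (hp : 1 < p) {s t : ℝ} (hs : 0 ≤ s) (ht : 0 ≤ t) :
    0 ≤ (s ^ (p - 1) - t ^ (p - 1)) * (s - t) := by
  rcases le_total s t with h | h
  · exact mul_nonneg_of_nonpos_of_nonpos
      (sub_nonpos.2 (Real.rpow_le_rpow hs h (by linarith))) (sub_nonpos.2 h)
  · exact mul_nonneg (sub_nonneg.2 (Real.rpow_le_rpow ht h (by linarith))) (sub_nonneg.2 h)

/-- Monotonicity of `a ↦ ‖a‖ ^ (p - 2) • a`. -/
theorem pLaplace_monotone (hp : 1 < p) (a b : E) :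
    0 ≤ ‖a‖ ^ (p - 2) * inner ℝ a (a - b) - ‖b‖ ^ (p - 2) * inner ℝ b (a - b) := by
  rw [← pLaplace_monotone_aux hp]
  have h1 := rpow_sub_mul_sub_nonneg hp (norm_nonneg a) (norm_nonneg b)
  have h2 : 0 ≤ ‖a‖ * ‖b‖ - inner ℝ a b := sub_nonneg.2 (real_inner_le_norm a b)
  positivity

/-- Strict monotonicity of `a ↦ ‖a‖ ^ (p - 2) • a`. -/
theorem eq_of_pLaplace_eq_zero (hp : 1 < p) {a b : E}
    (h : ‖a‖ ^ (p - 2) * inner ℝ a (a - b) - ‖b‖ ^ (p - 2) * inner ℝ b (a - b) = 0) : a = b := by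
  rw [← pLaplace_monotone_aux hp] at h
  have h1 := rpow_sub_mul_sub_nonneg hp (norm_nonneg a) (norm_nonneg b)
  have h2 : 0 ≤ ‖a‖ * ‖b‖ - inner ℝ a b := sub_nonneg.2 (real_inner_le_norm a b)
  have h3 : 0 ≤ (‖a‖ ^ (p - 2) + ‖b‖ ^ (p - 2)) * (‖a‖ * ‖b‖ - inner ℝ a b) := by positivity
  have h4 : (‖a‖ ^ (p - 1) - ‖b‖ ^ (p - 1)) * (‖a‖ - ‖b‖) = 0 := by linarith
  have h5 : (‖a‖ ^ (p - 2) + ‖b‖ ^ (p - 2)) * (‖a‖ * ‖b‖ - inner ℝ a b) = 0 := by linarith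
  have hnorm : ‖a‖ = ‖b‖ := by
    rcases mul_eq_zero.1 h4 with h | h
    · exact (Real.rpow_left_inj (norm_nonneg a) (norm_nonneg b) (by linarith)).1 (sub_eq_zero.1 h)
    · exact sub_eq_zero.1 h
  rcases (norm_nonneg a).eq_or_lt with ha | ha
  · rw [norm_eq_zero.1 ha.symm, norm_eq_zero.1 (hnorm.symm.trans ha.symm)]
  -- Both coefficients are positive since `a` and `b` have the same nonzero norm, so equality holds
  -- in Cauchy–Schwarz.
  have h6 : ‖a‖ * ‖b‖ - inner ℝ a b = 0 := by
    refine (mul_eq_zero.1 h5).resolve_left (ne_of_gt ?_)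
    have hb := ha
    rw [hnorm] at hb
    positivity
  rw [← sub_eq_zero, ← norm_eq_zero, ← sq_eq_zero_iff, norm_sub_sq_real]
  rw [hnorm] at h6 ⊢
  linarith

/-- Bounding both norms by their maximum replaces Young's inequality; only integrability is needed
from it. -/
theorem abs_pLaplace_le (hp : 1 < p) (a b : E) :
    |‖a‖ ^ (p - 2) * inner ℝ a b| ≤ ‖a‖ ^ p + ‖b‖ ^ p := by
  rcases (norm_nonneg a).eq_or_lt with ha | ha
  · rw [norm_eq_zero.1 ha.symm]
    simp only [inner_zero_left, mul_zero, abs_zero]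
    positivity
  set m := max ‖a‖ ‖b‖ with hm
  have hm0 : 0 < m := ha.trans_le (le_max_left _ _)
  calc |‖a‖ ^ (p - 2) * inner ℝ a b| ≤ ‖a‖ ^ (p - 2) * (‖a‖ * ‖b‖) := by
        rw [abs_mul, abs_of_nonneg (by positivity)]
        exact mul_le_mul_of_nonneg_left (abs_real_inner_le_norm a b) (by positivity)
    _ = ‖a‖ ^ (p - 1) * ‖b‖ := by
        rw [← mul_assoc, show p - 1 = p - 2 + 1 by ring, Real.rpow_add ha, Real.rpow_one]
    _ ≤ m ^ (p - 1) * m := by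
        refine mul_le_mul ?_ (le_max_right _ _) (norm_nonneg b) (by positivity)
        exact Real.rpow_le_rpow ha.le (le_max_left _ _) (by linarith)
    _ = m ^ p := by
        nth_rw 2 [← Real.rpow_one m]
        rw [← Real.rpow_add hm0, sub_add_cancel]
    _ ≤ ‖a‖ ^ p + ‖b‖ ^ p := by
        have h1 : 0 ≤ ‖a‖ ^ p := by positivity
        have h2 : 0 ≤ ‖b‖ ^ p := by positivity
        rcases max_choice ‖a‖ ‖b‖ with h | h <;> rw [hm, h] <;> linarith

variable {α : Type*} {mα : MeasurableSpace α} {ν : Measure α}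

omit [InnerProductSpace ℝ E] in
theorem MeasureTheory.MemLp.integrable_norm_rpow_ofReal (hp : 1 < p) {a : α → E}
    (ha : MemLp a (ENNReal.ofReal p) ν) : Integrable (fun x => ‖a x‖ ^ p) ν := by
  have := ha.integrable_norm_rpow (ENNReal.ofReal_pos.2 (by linarith)).ne' ENNReal.ofReal_ne_top
  rwa [ENNReal.toReal_ofReal (by linarith)] at this

theorem integrable_pLaplace (hp : 1 < p) {a b : α → E} (ha : MemLp a (ENNReal.ofReal p) ν)
    (hb : MemLp b (ENNReal.ofReal p) ν) :
    Integrable (fun x => ‖a x‖ ^ (p - 2) * inner ℝ (a x) (b x)) ν := by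
  refine ((ha.integrable_norm_rpow_ofReal hp).add (hb.integrable_norm_rpow_ofReal hp)).mono'
    ?_ (Eventually.of_forall fun x => abs_pLaplace_le hp _ _)
  exact ((ha.1.norm.aemeasurable.pow_const _).aestronglyMeasurable).mul (ha.1.inner hb.1)

/-- The hypothesis on `w` is the shape shared by a positive part of a difference and by its weak
gradient. -/
theorem ae_pLaplace_nonneg (hp : 1 < p) {a b w : α → E}
    (h : ∀ᵐ x ∂ν, w x = a x - b x ∨ w x = 0) :
    ∀ᵐ x ∂ν, 0 ≤ ‖a x‖ ^ (p - 2) * inner ℝ (a x) (w x)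
      - ‖b x‖ ^ (p - 2) * inner ℝ (b x) (w x) := by
  filter_upwards [h] with x hx
  rcases hx with hx | hx
  · rw [hx]
    exact pLaplace_monotone hp _ _
  · simp [hx]

theorem integral_pLaplace_mono (hp : 1 < p) {a b w : α → E}
    (ha : MemLp a (ENNReal.ofReal p) ν) (hb : MemLp b (ENNReal.ofReal p) ν)
    (hw : MemLp w (ENNReal.ofReal p) ν) (h : ∀ᵐ x ∂ν, w x = a x - b x ∨ w x = 0) :
    ∫ x, ‖b x‖ ^ (p - 2) * inner ℝ (b x) (w x) ∂ν
      ≤ ∫ x, ‖a x‖ ^ (p - 2) * inner ℝ (a x) (w x) ∂ν := by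
  rw [← sub_nonneg, ← integral_sub (integrable_pLaplace hp ha hw) (integrable_pLaplace hp hb hw)]
  exact integral_nonneg_of_ae (ae_pLaplace_nonneg hp h)

theorem ae_eq_zero_of_integral_pLaplace_le (hp : 1 < p) {a b w : α → E}
    (ha : MemLp a (ENNReal.ofReal p) ν) (hb : MemLp b (ENNReal.ofReal p) ν)
    (hw : MemLp w (ENNReal.ofReal p) ν) (h : ∀ᵐ x ∂ν, w x = a x - b x ∨ w x = 0)
    (hle : ∫ x, ‖a x‖ ^ (p - 2) * inner ℝ (a x) (w x) ∂ν
      ≤ ∫ x, ‖b x‖ ^ (p - 2) * inner ℝ (b x) (w x) ∂ν) : w =ᵐ[ν] 0 := by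
  have hi := (integrable_pLaplace hp ha hw).sub (integrable_pLaplace hp hb hw)
  have h0 := hle.antisymm (integral_pLaplace_mono hp ha hb hw h)
  rw [← sub_eq_zero, ← integral_sub (integrable_pLaplace hp ha hw)
    (integrable_pLaplace hp hb hw)] at h0
  filter_upwards [(integral_eq_zero_iff_of_nonneg_ae (ae_pLaplace_nonneg hp h) hi).1 h0, h]
    with x hx hxw
  rcases hxw with hxw | hxw
  · rw [hxw] at hx
    rw [hxw, eq_of_pLaplace_eq_zero hp hx]
    simp
  · exact hxw

end Monotonicity

/-! ### The weak form and its test with a positive part -/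

variable {d : ℕ} {p : ℝ}

/-- The left-hand side of the weak formulation. -/
def weakForm (D : Set (Rd d)) (p : ℝ) (μ : Measure (Rd d)) (u v : Rd d → ℝ) : ℝ :=
  (∫ x in D, ‖weakGrad u x‖ ^ (p - 2) * inner ℝ (weakGrad u x) (weakGrad v x)) +
    ∫ x, |u x| ^ (p - 2) * u x * v x ∂μ

/-- Makes the potential term the case `E = ℝ` of the gradient term, so one monotonicity argument
serves both. -/
theorem potential_eq_inner (s t : ℝ) :
    |s| ^ (p - 2) * s * t = ‖s‖ ^ (p - 2) * inner ℝ s t := by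
  simp [mul_assoc, mul_comm s t]

theorem weakForm_congr {D : Set (Rd d)} {μ : Measure (Rd d)} {u u' v : Rd d → ℝ}
    (hg : weakGrad u =ᵐ[volume.restrict D] weakGrad u') (hu : u =ᵐ[μ] u') :
    weakForm D p μ u v = weakForm D p μ u' v := by
  unfold weakForm
  congr 1
  · exact integral_congr_ae (by filter_upwards [hg] with x hx; rw [hx])
  · exact integral_congr_ae (by filter_upwards [hu] with x hx; rw [hx])

/-- A function whose weak gradient vanishes in `D` and which vanishes `μ`-almost everywhere has
norm zero. -/
theorem normMu_eq_zero (hp : 1 < p) {D : Set (Rd d)} {μ : Measure (Rd d)} {v : Rd d → ℝ}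
    (hg : weakGrad v =ᵐ[volume.restrict D] 0) (hv : v =ᵐ[μ] 0) : normMu D p μ v = 0 := by
  have hp0 : p ≠ 0 := by linarith
  have h1 : ∫ x in D, ‖weakGrad v x‖ ^ p = 0 := by
    refine integral_eq_zero_of_ae ?_
    filter_upwards [hg] with x hx
    simp [hx, hp0]
  have h2 : ∫ x, |v x| ^ p ∂μ = 0 := by
    refine integral_eq_zero_of_ae ?_
    filter_upwards [hv] with x hx
    simp [hx, hp0]
  rw [normMu, h1, h2, add_zero, Real.zero_rpow (one_div_ne_zero hp0)]

/-- Testing the difference of two equations with `(u₁ - u₂)⁺`. -/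
theorem posPart_sub_ae_eq_zero (hp : 1 < p) {D : Set (Rd d)} {μ : Measure (Rd d)}
    {u₁ u₂ : Rd d → ℝ} (h₁ : MemW1p p u₁) (h₂ : MemW1p p u₂)
    (hm₁ : MemLp u₁ (ENNReal.ofReal p) μ) (hm₂ : MemLp u₂ (ENNReal.ofReal p) μ)
    (hle : weakForm D p μ u₁ (fun x => max ((u₁ - u₂) x) 0)
      ≤ weakForm D p μ u₂ (fun x => max ((u₁ - u₂) x) 0)) :
    weakGrad (fun x => max ((u₁ - u₂) x) 0) =ᵐ[volume.restrict D] 0 ∧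
      (fun x => max ((u₁ - u₂) x) 0) =ᵐ[μ] 0 := by
  set v : Rd d → ℝ := fun x => max ((u₁ - u₂) x) 0 with hv
  have hvm : MemW1p p v := (h₁.sub h₂).posPart
  have hvμ : MemLp v (ENNReal.ofReal p) μ := (hm₁.sub hm₂).pos_part
  have hvg : ∀ᵐ x ∂volume.restrict D,
      weakGrad v x = weakGrad u₁ x - weakGrad u₂ x ∨ weakGrad v x = 0 := by
    refine ae_restrict_of_ae ?_
    filter_upwards [(h₁.sub h₂).weakGrad_posPart, h₁.weakGrad_sub h₂] with x hx1 hx2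
    rw [hx1]
    by_cases hx : 0 < (u₁ - u₂) x
    · left
      rw [indicator_of_mem (by exact hx), hx2, Pi.sub_apply]
    · right
      exact indicator_of_notMem (by exact hx) _
  have hvv : ∀ᵐ x ∂μ, v x = u₁ x - u₂ x ∨ v x = 0 :=
    Eventually.of_forall fun x => max_choice _ _
  have g₁ := h₁.memLp_weakGrad.restrict D
  have g₂ := h₂.memLp_weakGrad.restrict D
  have gv := hvm.memLp_weakGrad.restrict D
  simp only [weakForm, potential_eq_inner] at hle
  -- Both parts of the form are ordered one way and their sum the other way, so each is an equality.
  have m1 := integral_pLaplace_mono hp g₁ g₂ gv hvg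
  have m2 := integral_pLaplace_mono hp hm₁ hm₂ hvμ hvv
  exact ⟨ae_eq_zero_of_integral_pLaplace_le hp g₁ g₂ gv hvg (by linarith),
    ae_eq_zero_of_integral_pLaplace_le hp hm₁ hm₂ hvμ hvv (by linarith)⟩

/-! ### Comparison principles -/

/-- A space of quasi-continuous Sobolev functions closed under differences and positive parts. -/
structure IsSobolevLattice (p : ℝ) (V : Set (Rd d → ℝ)) : Prop where
  subset_sobolev : V ⊆ sobolev d p
  sub_mem : ∀ u ∈ V, ∀ v ∈ V, u - v ∈ V
  posPart_mem : ∀ u ∈ V, (fun x => max (u x) 0) ∈ V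

theorem isSobolevLattice_sobolev : IsSobolevLattice p (sobolev d p) :=
  ⟨subset_rfl, fun _ hu _ hv => sub_mem_sobolev hu hv, fun _ hu => posPart_mem_sobolev hu⟩

theorem isSobolevLattice_sobolevZero (D : Set (Rd d)) : IsSobolevLattice p (sobolevZero p D) :=
  ⟨fun _ hu => hu.1, fun _ hu _ hv => sub_mem_sobolevZero hu hv,
    fun _ hu => posPart_mem_sobolevZero hu⟩

namespace IsSobolevLattice

variable {V : Set (Rd d → ℝ)} (hV : IsSobolevLattice p V)
include hV

theorem sub_mem_sobolevMu {μ : Measure (Rd d)} {u v : Rd d → ℝ} (hu : u ∈ sobolevMu V p μ)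
    (hv : v ∈ sobolevMu V p μ) : u - v ∈ sobolevMu V p μ :=
  ⟨hV.sub_mem _ hu.1 _ hv.1, hu.2.sub hv.2⟩

theorem posPart_mem_sobolevMu {μ : Measure (Rd d)} {u : Rd d → ℝ} (hu : u ∈ sobolevMu V p μ) :
    (fun x => max (u x) 0) ∈ sobolevMu V p μ :=
  ⟨hV.posPart_mem _ hu.1, hu.2.pos_part⟩

/-- Comparison of solutions with ordered right-hand sides. -/
theorem comparison_rhs (hp : 1 < p) {D S : Set (Rd d)} {μ : Measure (Rd d)}
    (hdef : ∀ w ∈ V, weakGrad w =ᵐ[volume.restrict D] 0 → w ∈ sobolevMu V p μ →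
      normMu D p μ w = 0 → QuasiEverywhere p (fun x => x ∈ S → w x = 0))
    {f₁ f₂ : (Rd d → ℝ) → ℝ} (hf : DualLE V p μ f₁ f₂) {u₁ u₂ : Rd d → ℝ}
    (h₁ : IsWeakSolution V D p μ f₁ u₁) (h₂ : IsWeakSolution V D p μ f₂ u₂) :
    QuasiEverywhere p (fun x => x ∈ S → u₁ x ≤ u₂ x) := by
  have hv := hV.posPart_mem_sobolevMu (hV.sub_mem_sobolevMu h₁.1 h₂.1)
  have hle : weakForm D p μ u₁ (fun x => max ((u₁ - u₂) x) 0)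
      ≤ weakForm D p μ u₂ (fun x => max ((u₁ - u₂) x) 0) := by
    rw [weakForm, weakForm, h₁.2 _ hv, h₂.2 _ hv]
    exact hf _ hv fun x => le_max_right _ _
  obtain ⟨hg, hm⟩ := posPart_sub_ae_eq_zero hp (hV.subset_sobolev h₁.1.1).1
    (hV.subset_sobolev h₂.1.1).1 h₁.1.2 h₂.1.2 hle
  refine (hdef _ hv.1 hg hv (normMu_eq_zero hp hg hm)).mono fun x hx hxS => ?_
  have := hx hxS
  simpa using this

/-- Comparison of solutions with ordered measures and nonnegative right-hand side. -/
theorem comparison_measure (hp : 1 < p) {D S : Set (Rd d)} {μ₁ μ₂ : Measure (Rd d)}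
    (hμ₁ : IsCapacitary p μ₁) (hμ : μ₂ ≤ μ₁)
    (hdef : ∀ w ∈ V, weakGrad w =ᵐ[volume.restrict D] 0 → w ∈ sobolevMu V p μ₂ →
      normMu D p μ₂ w = 0 → QuasiEverywhere p (fun x => x ∈ S → w x = 0))
    {f : (Rd d → ℝ) → ℝ} (hf : DualLE V p μ₂ 0 f) {u₁ u₂ : Rd d → ℝ}
    (h₁ : IsWeakSolution V D p μ₁ f u₁) (h₂ : IsWeakSolution V D p μ₂ f u₂) :
    QuasiEverywhere p (fun x => x ∈ S → u₁ x ≤ u₂ x) := by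
  have hu₂ : MemW1p p u₂ := (hV.subset_sobolev h₂.1.1).1
  have hu₁ : MemW1p p u₁ := (hV.subset_sobolev h₁.1.1).1
  have hzero : (0 : Rd d → ℝ) ∈ sobolevMu V p μ₂ := by
    simpa using hV.sub_mem_sobolevMu h₂.1 h₂.1
  have hzero' : MemW1p p (0 : Rd d → ℝ) := (hV.subset_sobolev hzero.1).1
  -- the negative part of `u₂`
  set m : Rd d → ℝ := fun x => max (((0 : Rd d → ℝ) - u₂) x) 0 with hmdef
  have hm := hV.posPart_mem_sobolevMu (hV.sub_mem_sobolevMu hzero h₂.1)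
  have hgrad0 : weakGrad (0 : Rd d → ℝ) =ᵐ[volume] 0 := by
    filter_upwards [hzero'.hasWeakGradient.ae_eq_zero_on_zeros] with x hx using hx rfl
  have hform0 : weakForm D p μ₂ 0 m = 0 := by
    have h1 : ∫ x in D, ‖weakGrad (0 : Rd d → ℝ) x‖ ^ (p - 2)
        * inner ℝ (weakGrad (0 : Rd d → ℝ) x) (weakGrad m x) = 0 := by
      refine integral_eq_zero_of_ae ?_
      filter_upwards [ae_restrict_of_ae hgrad0] with x hx
      simp [hx]
    simp [weakForm, h1]
  -- The zero function solves the equation with right-hand side 0, and `f ≥ 0`, so it is compared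
  -- with `u₂`.
  obtain ⟨hmg, hmμ⟩ := posPart_sub_ae_eq_zero (D := D) hp hzero' hu₂ hzero.2 h₂.1.2 (by
    change weakForm D p μ₂ 0 m ≤ weakForm D p μ₂ u₂ m
    rw [hform0, weakForm, h₂.2 m hm]
    exact hf m hm fun x => le_max_right _ _)
  have hmq := hdef m hm.1 hmg hm (normMu_eq_zero hp hmg hmμ)
  -- replace `u₂` by its positive part
  set U : Rd d → ℝ := fun x => max (u₂ x) 0 with hU
  have hUmem := hV.posPart_mem_sobolevMu h₂.1
  have hUm : ∀ x, U x = u₂ x + m x := fun x => by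
    simp only [hU, hmdef, Pi.sub_apply, Pi.zero_apply, zero_sub]
    rcases le_total 0 (u₂ x) with h | h
    · rw [max_eq_left h, max_eq_right (by linarith), add_zero]
    · rw [max_eq_right h, max_eq_left (by linarith), add_neg_cancel]
  have hUeq : U = u₂ + m := funext hUm
  -- `U` gives the same form for `μ₂` as `u₂`, but is nonnegative at every point, so no exceptional
  -- set has to be measured by `μ₁`.
  have hUg : weakGrad u₂ =ᵐ[volume.restrict D] weakGrad U := by
    rw [hUeq]
    filter_upwards [ae_restrict_of_ae (hu₂.weakGrad_add (hV.subset_sobolev hm.1).1), hmg]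
      with x hx1 hx2
    rw [hx1, Pi.add_apply, hx2, Pi.zero_apply, add_zero]
  have hUμ : u₂ =ᵐ[μ₂] U := by
    filter_upwards [hmμ] with x hx
    rw [hUm, show m x = 0 from hx, add_zero]
  -- the test function
  set v : Rd d → ℝ := fun x => max ((u₁ - U) x) 0 with hv
  have hvV : v ∈ V := hV.posPart_mem _ (hV.sub_mem _ h₁.1.1 _ hUmem.1)
  -- `0 ≤ v ≤ |u₁|` because `U ≥ 0`. Since `u₂` is controlled only for `μ₂`, measurability for `μ₁`
  -- comes from quasi-continuity.
  have hvμ₁ : MemLp v (ENNReal.ofReal p) μ₁ := by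
    refine h₁.1.2.mono ((hV.subset_sobolev hvV).2.aestronglyMeasurable hμ₁)
      (Eventually.of_forall fun x => ?_)
    rw [Real.norm_of_nonneg (le_max_right _ _)]
    refine max_le ?_ (norm_nonneg _)
    have h1 : 0 ≤ U x := le_max_right _ _
    have h2 := le_abs_self (u₁ x)
    rw [Pi.sub_apply, Real.norm_eq_abs]
    linarith
  have hvμ₂ : v ∈ sobolevMu V p μ₂ := ⟨hvV, hvμ₁.mono_measure hμ⟩
  have hpot : ∫ x, |u₁ x| ^ (p - 2) * u₁ x * v x ∂μ₂
      ≤ ∫ x, |u₁ x| ^ (p - 2) * u₁ x * v x ∂μ₁ := by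
    refine integral_mono_measure hμ (Eventually.of_forall fun x => ?_) ?_
    · have hv0 : 0 ≤ v x := le_max_right _ _
      rcases hv0.eq_or_lt with h | h
      · simp [← h]
      · have h1 : 0 ≤ U x := le_max_right _ _
        have h2 : 0 < u₁ x - U x := by
          rcases lt_max_iff.1 (show 0 < max ((u₁ - U) x) 0 from h) with h | h
          · exact h
          · exact absurd h (lt_irrefl _)
        have h3 : 0 ≤ u₁ x := by linarith
        simp only [Pi.zero_apply]
        positivity
    · simp only [potential_eq_inner]
      exact integrable_pLaplace hp h₁.1.2 hvμ₁
  -- Through `f v`, the form of `U` for `μ₂` equals that of `u₁` for `μ₁`, and lowering the measure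
  -- lowers the latter.
  have hle : weakForm D p μ₂ u₁ v ≤ weakForm D p μ₂ U v := by
    rw [← weakForm_congr hUg hUμ, weakForm, weakForm, h₂.2 v hvμ₂, ← h₁.2 v ⟨hvV, hvμ₁⟩]
    linarith
  obtain ⟨hvg, hvμ⟩ := posPart_sub_ae_eq_zero hp hu₁ (hV.subset_sobolev hUmem.1).1
    (h₁.1.2.mono_measure hμ) hUmem.2 hle
  refine ((hdef v hvV hvg hvμ₂ (normMu_eq_zero hp hvg hvμ)).and hmq).mono fun x hx hxS => ?_
  have e1 : max ((u₁ - U) x) 0 = 0 := hx.1 hxS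
  have e2 := hx.2 hxS
  rw [max_eq_right_iff, Pi.sub_apply, hUm, e2] at e1
  linarith

end IsSobolevLattice

end

/-! ### The two state spaces -/

theorem proposition3p3 (d : ℕ) (hd : 1 ≤ d) (p : ℝ) (hp : 1 < p)
    (D : Set (Rd d)) (hD : IsOpen D) :
    -- state space built on `W^{1,p}_0(D)`
    ((∀ μ₁ μ₂ : Measure (Rd d), IsCapacitary p μ₁ → IsCapacitary p μ₂ → μ₂ ≤ μ₁ →
        ∀ f : (Rd d → ℝ) → ℝ, IsDual (sobolevZero p D) D p μ₂ f →
          DualLE (sobolevZero p D) p μ₂ 0 f →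
          ∀ u₁ u₂ : Rd d → ℝ,
            IsWeakSolution (sobolevZero p D) D p μ₁ f u₁ →
            IsWeakSolution (sobolevZero p D) D p μ₂ f u₂ →
            QuasiEverywhere p (fun x => u₁ x ≤ u₂ x)) ∧
      (∀ μ : Measure (Rd d), IsCapacitary p μ →
        ∀ f₁ f₂ : (Rd d → ℝ) → ℝ, IsDual (sobolevZero p D) D p μ f₁ →
          IsDual (sobolevZero p D) D p μ f₂ →
          DualLE (sobolevZero p D) p μ f₁ f₂ →
          ∀ u₁ u₂ : Rd d → ℝ,
            IsWeakSolution (sobolevZero p D) D p μ f₁ u₁ →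
            IsWeakSolution (sobolevZero p D) D p μ f₂ u₂ →
            QuasiEverywhere p (fun x => u₁ x ≤ u₂ x))) ∧
    -- state space built on all of `W^{1,p}(ℝ^d)`
    ((∀ μ₁ μ₂ : Measure (Rd d), IsCapacitary p μ₁ → IsCapacitary p μ₂ → μ₂ ≤ μ₁ →
        NormMuDefinite (sobolev d p) D p μ₂ →
        ∀ f : (Rd d → ℝ) → ℝ, IsDual (sobolev d p) D p μ₂ f →
          DualLE (sobolev d p) p μ₂ 0 f →
          ∀ u₁ u₂ : Rd d → ℝ,
            IsWeakSolution (sobolev d p) D p μ₁ f u₁ →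
            IsWeakSolution (sobolev d p) D p μ₂ f u₂ →
            QuasiEverywhere p (fun x => x ∈ D → u₁ x ≤ u₂ x)) ∧
      (∀ μ : Measure (Rd d), IsCapacitary p μ → NormMuDefinite (sobolev d p) D p μ →
        ∀ f₁ f₂ : (Rd d → ℝ) → ℝ, IsDual (sobolev d p) D p μ f₁ →
          IsDual (sobolev d p) D p μ f₂ →
          DualLE (sobolev d p) p μ f₁ f₂ →
          ∀ u₁ u₂ : Rd d → ℝ,
            IsWeakSolution (sobolev d p) D p μ f₁ u₁ →
            IsWeakSolution (sobolev d p) D p μ f₂ u₂ →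
            QuasiEverywhere p (fun x => x ∈ D → u₁ x ≤ u₂ x))) := by
  -- Definiteness for `W^{1,p}_0(D)` uses the gradient alone and holds on all of `ℝ^d`, hence `univ`
  -- in place of `D`.
  have hzero : ∀ (μ : Measure (Rd d)), ∀ w ∈ sobolevZero p D,
      weakGrad w =ᵐ[volume.restrict D] 0 → w ∈ sobolevMu (sobolevZero p D) p μ →
      normMu D p μ w = 0 → QuasiEverywhere p (fun x => x ∈ univ → w x = 0) :=
    fun μ w hw hg _ _ => (quasiEverywhere_eq_zero_of_mem_sobolevZero hd hp hw
      ((ae_restrict_iff' hD.measurableSet).1 hg)).mono fun x hx _ => hx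
  refine ⟨⟨fun μ₁ μ₂ hμ₁ _ hμ f _ hf u₁ u₂ h₁ h₂ => ?_, fun μ _ f₁ f₂ _ _ hf u₁ u₂ h₁ h₂ => ?_⟩,
    fun μ₁ μ₂ hμ₁ _ hμ hdef f _ hf u₁ u₂ h₁ h₂ => ?_,
    fun μ _ hdef f₁ f₂ _ _ hf u₁ u₂ h₁ h₂ => ?_⟩
  · exact ((isSobolevLattice_sobolevZero D).comparison_measure hp hμ₁ hμ (hzero μ₂) hf h₁ h₂).mono
      fun x hx => hx (mem_univ x)
  · exact ((isSobolevLattice_sobolevZero D).comparison_rhs hp (hzero μ) hf h₁ h₂).mono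
      fun x hx => hx (mem_univ x)
  · exact isSobolevLattice_sobolev.comparison_measure hp hμ₁ hμ
      (fun w _ _ hw h0 => hdef w hw h0) hf h₁ h₂
  · exact isSobolevLattice_sobolev.comparison_rhs hp (fun w _ _ hw h0 => hdef w hw h0) hf h₁ h₂
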